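/- Let $\Delta\ge 1$, $\sigma>0$, $q=(1,2,\dots,\Delta)^\top$, and let $p_1,p_2$ be probability mass functions on $\{1,\dots,\Delta\}$ with all entries strictly positive. Let $S_1,S_2,\dots\in\{1,2\}$ be the random state sequence that starts in state 1 and alternates between phases of state 1 and phases of state 2, all phase durations being independent and the durations of state-$m$ phases having law $p_m$. For $t\ge1$ let $\mathcal S^t$ be the set of sequences $s^t\in\{1,2\}^t$ with $\mathbb P(S^t=s^t)>0$, and $C_t=|\mathcal S^t|$. For $s^t\in\mathcal S^t$ let $N_{m,d}(s^t)$ be the number of state-$m$ phases (maximal runs of state $m$) of length $d$ in $s^t$, let $V(s^t)=(N_{m,d}(s^t)/t)_{m\in\{1,2\},\,1\le d\le\Delta}\in\mathbb R^{2\times\Delta}$ be its type, and let $\Theta_2(s^t)=\frac1t|\{k\le t:s_k=2\}|$. For each $t$ let $\{\mathcal Z_{s^t}:s^t\in\mathcal S^t\}$ be independent Gaussian random variables on a common probability space $(\Omega,\mathcal F,\mathbb P)$ (no assumption is made on the joint law for different $t$), with $\mathcal Z_{s^t}\sim\mathcal N(0,\sigma^2\Theta_2(s^t)/t)$, and let $$Q_t^{\mathcal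 Z}(B)=\frac{1}{C_t}\,\bigl|\{s^t\in\mathcal S^t:(V(s^t),\mathcal Z_{s^t})\in B\}\bigr|,\qquad B\in\mathcal B(\mathbb R^{2\Delta+1}).$$ Let $\psi$ be the unique positive zero of $x^\Delta-x^{\Delta-1}-\dots-x-1$, let $$\mathcal V=\{\nu=(\nu_1,\nu_2)\in\mathbb R_+^{2\times\Delta}:\ \mathbb 1^\top\nu_1=\mathbb 1^\top\nu_2,\ q^\top\nu_1+q^\top\nu_2=1\},$$ $$H(\lambda)=-\sum_{d=1}^{\Delta}\lambda_d\log\frac{\lambda_d}{\mathbb 1^\top\lambda}\quad(\lambda\in\mathbb R_+^\Delta,\ 0\log 0=0),\qquad J_\nu(\xi)=\frac{\xi^2}{2\sigma^2\,q^\top\nu_2},$$ and let $I:\mathbb R^{2\Delta+1}\to[0,+\infty]$ be given by $$I(\nu,\xi)=\log\psi-H(\nu_1)-H(\nu_2)+J_\nu(\xi)\quad\text{if }\nu\in\mathcal V\text{ and }H(\nu_1)+H(\nu_2)\ge J_\nu(\xi),$$ and $I(\nu,\xi)=+\infty$ otherwise (for $\sigma=1$, $J_\nu(\xi)=\xi^2/(2q^\top\nu_2)$).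 Then $I$ is a rate function (nonnegative and lower semicontinuous), and the random measures $Q_t^{\mathcal Z}$ satisfy with probability one the large deviations principle with rate function $I$: for every closed $F\subseteq\mathbb R^{2\Delta+1}$, almost surely $$\limsup_{t\to\infty}\frac1t\log Q_t^{\mathcal Z}(F)\le-\inf_{x\in F}I(x),$$ and for every open $E\subseteq\mathbb R^{2\Delta+1}$, almost surely $$\liminf_{t\to\infty}\frac1t\log Q_t^{\mathcal Z}(E)\ge-\inf_{x\in E}I(x).$$ -/

import Mathlib

open MeasureTheory ProbabilityTheory Filter

noncomputable section

namespace RandomDuration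

/-! States: `0 : Fin 2` is state 1 and `1 : Fin 2` is state 2. A state sequence of length `t` is a
map `Fin t → Fin 2`; the index `k` stands for the time `k + 1`. An index `d : Fin Δ` stands for the
duration `d + 1 ∈ {1, …, Δ}`. -/

/-- The state during the `i`-th phase (`i = 0, 1, 2, …`): phases alternate, starting in state 1. -/
def phaseState (i : ℕ) : Fin 2 := if Even i then 0 else 1

/-- The switching time `T_i`: the sum of the first `i` phase durations. -/
def switchTime {Δ t : ℕ} (D : Fin t → Fin Δ) (i : ℕ) : ℕ :=
  ∑ j : Fin t, if (j : ℕ) < i then (D j : ℕ) + 1 else 0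

/-- `s` is the state sequence whose consecutive phase durations are given by `D`. Every phase lasts
at least one time unit, so the first `t` phases determine the states up to time `t`. -/
def Generates {Δ t : ℕ} (D : Fin t → Fin Δ) (s : Fin t → Fin 2) : Prop :=
  ∀ i k : Fin t, switchTime D i ≤ k → (k : ℕ) < switchTime D ((i : ℕ) + 1) → s k = phaseState i

open Classical in
/-- The probability that the first `t` states are `s`, when the durations of all phases are
independent and those of the state-`m` phases have probability mass function `p m`. -/
def seqProb {Δ : ℕ} (p : Fin 2 → Fin Δ → ℝ) {t : ℕ} (s : Fin t → Fin 2) : ℝ :=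
  ∑ D : Fin t → Fin Δ with Generates D s, ∏ i : Fin t, p (phaseState i) (D i)

open Classical in
/-- The set of feasible state sequences of length `t`: those of positive probability. -/
def feasible {Δ : ℕ} (p : Fin 2 → Fin Δ → ℝ) (t : ℕ) : Finset (Fin t → Fin 2) :=
  Finset.univ.filter fun s => 0 < seqProb p s

/-- `s` has a state-`m` phase (a maximal run of state `m`) of length `d` occupying the indices
`a, …, a + d - 1`. -/
def IsPhase {t : ℕ} (s : Fin t → Fin 2) (m : Fin 2) (a d : ℕ) : Prop :=
  a + d ≤ t ∧ (∀ k : Fin t, a ≤ k → (k : ℕ) < a + d → s k = m) ∧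
    (∀ k : Fin t, (k : ℕ) + 1 = a → s k ≠ m) ∧ (∀ k : Fin t, (k : ℕ) = a + d → s k ≠ m)

open Classical in
/-- The number of state-`m` phases of length `d` in `s` (for `d ≥ 1`). -/
def phaseCount {t : ℕ} (s : Fin t → Fin 2) (m : Fin 2) (d : ℕ) : ℕ :=
  ((Finset.range t).filter fun a => IsPhase s m a d).card

/-- The type `V(s)` of a state sequence: phase counts normalized by `t`. -/
def seqType (Δ : ℕ) {t : ℕ} (s : Fin t → Fin 2) : Fin 2 → Fin Δ → ℝ :=
  fun m d => (phaseCount s m ((d : ℕ) + 1) : ℝ) / t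

/-- The fraction of time that `s` spends in state 2. -/
def fracState2 {t : ℕ} (s : Fin t → Fin 2) : ℝ :=
  ((Finset.univ.filter fun k => s k = 1).card : ℝ) / t

/-- `qᵀ l` for `q = (1, 2, …, Δ)`. -/
def qDot {Δ : ℕ} (l : Fin Δ → ℝ) : ℝ := ∑ d : Fin Δ, (((d : ℕ) : ℝ) + 1) * l d

/-- The limiting set of types. -/
def typeSet (Δ : ℕ) : Set (Fin 2 → Fin Δ → ℝ) :=
  {ν | (∀ m d, 0 ≤ ν m d) ∧ ∑ d, ν 0 d = ∑ d, ν 1 d ∧ qDot (ν 0) + qDot (ν 1) = 1}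

/-- The entropy `H(l) = - ∑ l_d log (l_d / ∑ l)` of a nonnegative vector, which is the exponential
growth rate in `t` of the multinomial coefficient `(t ∑ l)! / ∏ (t l_d)!`. -/
def entropy {Δ : ℕ} (l : Fin Δ → ℝ) : ℝ := -∑ d, l d * Real.log (l d / ∑ e, l e)

/-- `J_ν(ξ) = ξ² / (2 σ² qᵀν₂)`. -/
def gaussRate {Δ : ℕ} (σ : ℝ) (ν : Fin 2 → Fin Δ → ℝ) (ξ : ℝ) : ℝ :=
  ξ ^ 2 / (2 * σ ^ 2 * qDot (ν 1))

open Classical in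
/-- The rate function `I(ν, ξ)`. -/
def rate {Δ : ℕ} (ψ σ : ℝ) (x : (Fin 2 → Fin Δ → ℝ) × ℝ) : EReal :=
  if x.1 ∈ typeSet Δ ∧ gaussRate σ x.1 x.2 ≤ entropy (x.1 0) + entropy (x.1 1) then
    ((Real.log ψ - entropy (x.1 0) - entropy (x.1 1) + gaussRate σ x.1 x.2 : ℝ) : EReal)
  else ⊤

/-- The empirical measure of `(V(s), z s)` for `s` uniform on the feasible sequences of
length `t`. -/
def empMeasure {Δ : ℕ} (p : Fin 2 → Fin Δ → ℝ) (t : ℕ) (z : (Fin t → Fin 2) → ℝ) :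
    Measure ((Fin 2 → Fin Δ → ℝ) × ℝ) :=
  ((feasible p t).card : ENNReal)⁻¹ • ∑ s ∈ feasible p t, Measure.dirac (seqType Δ s, z s)

/-- The random measures `Q t ω`, `t = 1, 2, …`, satisfy the large deviations principle with
probability one, with rate function `I`. -/
structure SatisfiesLDPAlmostSurely {Ω X : Type*} [MeasurableSpace Ω] [TopologicalSpace X]
    [MeasurableSpace X] (P : Measure Ω) (Q : ℕ → Ω → Measure X) (I : X → EReal) : Prop where
  nonneg : ∀ x, 0 ≤ I x
  lowerSemicontinuous : LowerSemicontinuous I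
  upper : ∀ F : Set X, IsClosed F → ∀ᵐ ω ∂P,
    limsup (fun t : ℕ => ENNReal.log (Q t ω F) / (t : EReal)) atTop ≤ -(⨅ x ∈ F, I x)
  lower : ∀ E : Set X, IsOpen E → ∀ᵐ ω ∂P,
    -(⨅ x ∈ E, I x) ≤ liminf (fun t : ℕ => ENNReal.log (Q t ω E) / (t : EReal)) atTop

end RandomDuration

end

noncomputable section

namespace RandomDuration

open Topology

/-! The empirical measure counts sequences, so the proof estimates how many sequences have type near
`ν`, and then how many of their Gaussians fall near `ξ`.

Since all `p m d` are positive, feasible sequences correspond to compositions of `t` with parts at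
most `Δ`. Give each state-`m` phase of length `d` a weight, where the weights of each state form a
probability vector `π m`. The total weight of the feasible sequences is then the probability that
`t` is a renewal epoch, so it lies between a constant `κ > 0` and `1` (`sum_listWeight_le_one`,
`le_sum_listWeight`). The weight of one sequence is `exp (t * logWeight π V)`, a function of its
type `V` alone. Three choices of `π` give all the counts. Weights `ψ ^ (-d)` make every sequence
weigh the same, so `C_t` is of order `ψ ^ t` (`card_feasible_bounds`). The normalized `ν`, mixed
with the uniform law, gives at most `exp (t (H + ε))` sequences near `ν`, where `H = totalEntropy
ν`. The normalized `ν` itself, for positive `ν`, gives the matching lower bound: by the strict Gibbs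
inequality and compactness, the weight of types away from `ν` decays exponentially.

A Gaussian of variance `σ² Θ₂ / t` lies near `ξ` with probability about `exp (-t J)`, so about `exp
(t (H - J))` hits are expected near `(ν, ξ)`. Markov's inequality bounds the hits from above. When
`J > H` it rules out any hit, because the number of hits is an integer; this is why the rate is
infinite there. When `J < H`, Chebyshev's inequality gives a matching lower bound. All failure
probabilities decay exponentially, so the first Borel–Cantelli lemma applies whatever the joint law
for different `t`. Boundary points `J = H` are reached by shrinking `ξ`, except when `ξ = 0`, where
a single sequence suffices (`lower_of_eq_zero`). Compactness turns the local upper bounds into one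
for closed sets. -/

/-! ### Feasible sequences as compositions with parts at most `Δ` -/

theorem phaseState_succ_ne (i : ℕ) : phaseState (i + 1) ≠ phaseState i := by
  unfold phaseState
  by_cases h : Even i <;> simp [Nat.even_add_one, h]

/-- The state sequence whose successive phases have the lengths of the blocks of `c`. -/
def compSeq {t : ℕ} (c : Composition t) : Fin t → Fin 2 := fun k => phaseState (c.index k)

theorem index_eq_of_mem {t : ℕ} (c : Composition t) (i : Fin c.length) (k : Fin t)
    (h1 : c.sizeUpTo i ≤ k) (h2 : (k : ℕ) < c.sizeUpTo (i + 1)) : c.index k = i := by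
  symm
  rw [← c.mem_range_embedding_iff', c.mem_range_embedding_iff]
  exact ⟨h1, h2⟩

/-- Consecutive blocks carry different states, so maximal runs are exactly blocks. The case `d = 0`
is excluded because an empty run of `m` would be found inside every longer run of the other state.
-/
theorem isPhase_compSeq_iff {t : ℕ} (c : Composition t) (m : Fin 2) (a d : ℕ) (hd : 1 ≤ d) :
    IsPhase (compSeq c) m a d ↔
      ∃ i : Fin c.length, phaseState i = m ∧ c.sizeUpTo i = a ∧ c.blocksFun i = d := by
  constructor
  · rintro ⟨hat, hm, hl, hr⟩
    have hlt : a < t := by omega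
    set i := c.index ⟨a, hlt⟩ with hi
    have h1 : c.sizeUpTo i ≤ a := c.sizeUpTo_index_le ⟨a, hlt⟩
    have h2 : a < c.sizeUpTo (i + 1) := c.lt_sizeUpTo_index_succ ⟨a, hlt⟩
    have hmi : phaseState i = m := hm ⟨a, hlt⟩ le_rfl (by simp; omega)
    have hT : c.sizeUpTo (i + 1) ≤ t := c.sizeUpTo_le _
    have hsucc := c.sizeUpTo_succ' i
    have ha : c.sizeUpTo i = a := by
      by_contra hne
      have hk : a - 1 < t := by omega
      refine hl ⟨a - 1, hk⟩ (by simp; omega) ?_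
      have := index_eq_of_mem c i ⟨a - 1, hk⟩ (by simp; omega) (by simp; omega)
      simp [compSeq, this, hmi]
    have hle : a + d ≤ c.sizeUpTo (i + 1) := by
      by_contra hgt
      have hk : c.sizeUpTo (i + 1) < t := by omega
      have h3 := hm ⟨_, hk⟩ (by simp; omega) (by simp; omega)
      have hlen : (i : ℕ) + 1 < c.length := by
        by_contra hge
        rw [c.sizeUpTo_ofLength_le _ (by omega)] at hk
        omega
      have := index_eq_of_mem c ⟨i + 1, hlen⟩ ⟨_, hk⟩ le_rfl
        (by simpa using c.sizeUpTo_strict_mono hlen)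
      rw [compSeq, this, ← hmi] at h3
      exact phaseState_succ_ne _ h3
    have hge : c.sizeUpTo (i + 1) ≤ a + d := by
      by_contra hgt
      have hk : a + d < t := by omega
      refine hr ⟨a + d, hk⟩ rfl ?_
      have := index_eq_of_mem c i ⟨a + d, hk⟩ (by simp; omega) (by simp; omega)
      simp [compSeq, this, hmi]
    exact ⟨i, hmi, ha, by omega⟩
  · rintro ⟨i, rfl, rfl, rfl⟩
    have hsucc := c.sizeUpTo_succ' i
    refine ⟨by rw [← hsucc]; exact c.sizeUpTo_le _, fun k h1 h2 => ?_, fun k hk => ?_, fun k hk => ?_⟩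
    · rw [compSeq, index_eq_of_mem c i k h1 (by omega)]
    · have hi : 0 < (i : ℕ) := by
        by_contra h0
        have : (i : ℕ) = 0 := by omega
        simp [this] at hk
      have hl : (i : ℕ) - 1 < c.length := by omega
      have hs := c.sizeUpTo_succ hl
      have hp := c.sizeUpTo_strict_mono hl
      have he : (i : ℕ) - 1 + 1 = i := by omega
      rw [he] at hs hp
      have := index_eq_of_mem c ⟨i - 1, hl⟩ k (by simp; omega) (by simp [he]; omega)
      rw [compSeq, this]
      have h3 := phaseState_succ_ne ((i : ℕ) - 1)
      rw [he] at h3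
      exact h3.symm
    · have hl : (i : ℕ) + 1 < c.length := by
        by_contra h0
        have := c.sizeUpTo_ofLength_le (i + 1) (by omega)
        omega
      have hp := c.sizeUpTo_strict_mono hl
      have := index_eq_of_mem c ⟨i + 1, hl⟩ k (by simp; omega) (by simp; omega)
      rw [compSeq, this]
      exact phaseState_succ_ne _

theorem sizeUpTo_lt_of_lt {t : ℕ} (c : Composition t) {i j : ℕ} (h : i < j) (hj : j ≤ c.length) :
    c.sizeUpTo i < c.sizeUpTo j :=
  lt_of_lt_of_le (c.sizeUpTo_strict_mono (by omega)) (c.monotone_sizeUpTo h)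

theorem sizeUpTo_injective {t : ℕ} (c : Composition t) :
    Function.Injective fun i : Fin c.length => c.sizeUpTo i := by
  intro i j h
  rcases lt_trichotomy (i : ℕ) j with h1 | h1 | h1
  · exact absurd h (sizeUpTo_lt_of_lt c h1 j.2.le).ne
  · exact Fin.ext h1
  · exact absurd h (sizeUpTo_lt_of_lt c h1 i.2.le).ne'

theorem phaseCount_compSeq {t : ℕ} (c : Composition t) (m : Fin 2) (d : ℕ) (hd : 1 ≤ d) :
    phaseCount (compSeq c) m d =
      (Finset.univ.filter fun i : Fin c.length => phaseState i = m ∧ c.blocksFun i = d).card := by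
  classical
  rw [phaseCount, ← Finset.card_image_of_injective _ (sizeUpTo_injective c)]
  congr 1
  ext a
  simp only [Finset.mem_filter, Finset.mem_range, Finset.mem_image, Finset.mem_univ, true_and,
    isPhase_compSeq_iff c m a d hd]
  constructor
  · rintro ⟨-, i, h1, h2, h3⟩
    exact ⟨i, ⟨h1, h3⟩, h2⟩
  · rintro ⟨i, ⟨h1, h3⟩, h2⟩
    refine ⟨?_, i, h1, h2, h3⟩
    rw [← h2]
    exact lt_of_lt_of_le (c.sizeUpTo_strict_mono i.2) (c.sizeUpTo_le _)

/-- The right side mentions only the sequence `compSeq c`, so the sequence determines the boundaries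
and hence the composition. -/
theorem mem_boundaries_iff {t : ℕ} (c : Composition t) (a : Fin (t + 1)) :
    a ∈ c.boundaries ↔ (a : ℕ) = t ∨ ∃ m d, 1 ≤ d ∧ IsPhase (compSeq c) m a d := by
  have key : (∃ m d, 1 ≤ d ∧ IsPhase (compSeq c) m a d) ↔
      ∃ i : Fin c.length, c.sizeUpTo i = a := by
    constructor
    · rintro ⟨m, d, hd, h⟩
      obtain ⟨i, -, h, -⟩ := (isPhase_compSeq_iff c m a d hd).1 h
      exact ⟨i, h⟩
    · rintro ⟨i, h⟩
      exact ⟨phaseState i, c.blocksFun i, c.one_le_blocksFun i,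
        (isPhase_compSeq_iff c _ a _ (c.one_le_blocksFun i)).2 ⟨i, rfl, h, rfl⟩⟩
  rw [key]
  simp only [Composition.boundaries, Finset.mem_map, Finset.mem_univ, true_and]
  constructor
  · rintro ⟨j, rfl⟩
    refine Fin.lastCases ?_ (fun i => ?_) j
    · left; simp
    · right; exact ⟨i, rfl⟩
  · rintro (h | ⟨i, h⟩)
    · refine ⟨Fin.last _, Fin.ext ?_⟩
      simp [h]
    · exact ⟨i.castSucc, Fin.ext h⟩

theorem compSeq_injective {t : ℕ} : Function.Injective (compSeq : Composition t → Fin t → Fin 2) := by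
  intro c c' h
  apply (compositionEquiv t).injective
  change c.toCompositionAsSet = c'.toCompositionAsSet
  ext a
  change a ∈ c.boundaries ↔ a ∈ c'.boundaries
  rw [mem_boundaries_iff, mem_boundaries_iff, h]

theorem switchTime_zero {Δ t : ℕ} (D : Fin t → Fin Δ) : switchTime D 0 = 0 := by
  simp [switchTime]

theorem switchTime_succ {Δ t : ℕ} (D : Fin t → Fin Δ) (i : Fin t) :
    switchTime D (i + 1) = switchTime D i + (D i + 1) := by
  unfold switchTime
  have : ∀ j : Fin t, (if (j : ℕ) < i + 1 then (D j : ℕ) + 1 else 0) =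
      (if (j : ℕ) < i then (D j : ℕ) + 1 else 0) + if j = i then (D i : ℕ) + 1 else 0 := by
    intro j
    by_cases h : j = i
    · subst h; simp
    · have : (j : ℕ) ≠ i := fun h' => h (Fin.ext h')
      simp only [h, if_false, add_zero]
      congr 1
      simp only [eq_iff_iff]
      omega
  simp_rw [this, Finset.sum_add_distrib]
  simp

theorem le_switchTime {Δ t : ℕ} (D : Fin t → Fin Δ) (i : ℕ) (hi : i ≤ t) : i ≤ switchTime D i := by
  induction i with
  | zero => simp
  | succ i ih =>
    have := switchTime_succ D ⟨i, hi⟩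
    simp only at this
    have := ih (by omega)
    omega

theorem switchTime_monotone {Δ t : ℕ} (D : Fin t → Fin Δ) : Monotone (switchTime D) := by
  intro i j h
  refine Finset.sum_le_sum fun k _ => ?_
  split_ifs <;> omega

theorem compSeq_mem_feasible {Δ t : ℕ} (p : Fin 2 → Fin Δ → ℝ) (hp : ∀ m d, 0 < p m d)
    (c : Composition t) (hc : ∀ b ∈ c.blocks, b ≤ Δ) : compSeq c ∈ feasible p t := by
  classical
  have hlen : c.length ≤ t := c.length_le
  have hb : ∀ i : Fin c.length, c.blocksFun i - 1 < Δ := fun i => by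
    have := hc _ (c.blocksFun_mem_blocks i)
    have := c.one_le_blocksFun i
    omega
  have hΔ : t ≠ 0 → 0 < Δ := fun ht => by
    have : 0 < c.length := c.length_pos_iff.2 (Nat.pos_of_ne_zero ht)
    exact Nat.zero_lt_of_lt (hb ⟨0, this⟩)
  -- Past the last block any duration will do: those phases start at time `t` or later and constrain
  -- no state.
  let D : Fin t → Fin Δ := fun j =>
    if h : (j : ℕ) < c.length then ⟨c.blocksFun ⟨j, h⟩ - 1, hb _⟩
    else ⟨0, hΔ (by have := j.2; omega)⟩
  have hT : ∀ i : ℕ, i ≤ c.length → switchTime D i = c.sizeUpTo i := by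
    intro i
    induction i with
    | zero => simp [switchTime_zero]
    | succ i ih =>
      intro hi
      have hi' : i < t := by omega
      have h1 := switchTime_succ D ⟨i, hi'⟩
      have h2 := c.sizeUpTo_succ' ⟨i, hi⟩
      have h3 := c.one_le_blocksFun ⟨i, hi⟩
      simp only [D, dif_pos (show i < c.length from hi)] at h1 h2
      rw [h1, h2, ih (by omega)]
      omega
  have hgen : Generates D (compSeq c) := by
    intro i k h1 h2
    by_cases hi : (i : ℕ) < c.length
    · rw [hT _ hi.le] at h1
      rw [hT _ hi] at h2
      rw [compSeq, index_eq_of_mem c ⟨i, hi⟩ k h1 h2]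
    · have h3 := switchTime_monotone D (not_lt.1 hi)
      rw [hT _ le_rfl, c.sizeUpTo_length] at h3
      have := k.2
      omega
  rw [feasible, Finset.mem_filter, seqProb]
  exact ⟨Finset.mem_univ _, Finset.sum_pos (fun D _ => Finset.prod_pos fun i _ => hp _ _)
    ⟨D, Finset.mem_filter.2 ⟨Finset.mem_univ _, hgen⟩⟩⟩

theorem sum_take_ofFn {n : ℕ} (f : ℕ → ℕ) (i : ℕ) (hi : i ≤ n) :
    ((List.ofFn fun j : Fin n => f j).take i).sum = ∑ j ∈ Finset.range i, f j := by
  induction i with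
  | zero => simp
  | succ i ih =>
    rw [List.sum_take_succ _ _ (by simpa using hi), ih (by omega), Finset.sum_range_succ]
    simp

theorem exists_compSeq_of_mem_feasible {Δ t : ℕ} (p : Fin 2 → Fin Δ → ℝ) {s : Fin t → Fin 2}
    (hs : s ∈ feasible p t) : ∃ c : Composition t, (∀ b ∈ c.blocks, b ≤ Δ) ∧ compSeq c = s := by
  classical
  rw [feasible, Finset.mem_filter, seqProb] at hs
  obtain ⟨D, hD⟩ : ∃ D : Fin t → Fin Δ, Generates D s := by
    by_contra hno
    rw [Finset.filter_false_of_mem fun D _ hD => hno ⟨D, hD⟩] at hs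
    simp at hs
  have hex : ∃ n, t ≤ switchTime D n := ⟨t, le_switchTime D t le_rfl⟩
  set n := Nat.find hex with hn
  have hnt : n ≤ t := Nat.find_le (le_switchTime D t le_rfl)
  have hlt : ∀ i < n, switchTime D i < t := fun i hi => not_le.1 (Nat.find_min hex hi)
  have hT : t ≤ switchTime D n := Nat.find_spec hex
  -- Durations are cut at time `t`. Only the last phase can be shortened, and it keeps a length
  -- between `1` and `Δ`.
  set e : ℕ → ℕ := fun i => min (switchTime D (i + 1)) t - min (switchTime D i) t with he
  have hmono : Monotone fun i => min (switchTime D i) t := fun i j h =>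
    min_le_min_right _ (switchTime_monotone D h)
  have hsum : ∀ i, ∑ j ∈ Finset.range i, e j = min (switchTime D i) t := fun i => by
    rw [he, Finset.sum_range_tsub hmono]
    simp [switchTime_zero]
  have hsucc : ∀ i < n, ∃ hi : i < t, switchTime D (i + 1) = switchTime D i + (D ⟨i, hi⟩ + 1) :=
    fun i hi => ⟨by omega, switchTime_succ D ⟨i, by omega⟩⟩
  have hpos : ∀ i < n, 0 < e i ∧ e i ≤ Δ := fun i hi => by
    obtain ⟨hit, h1⟩ := hsucc i hi
    have h2 := hlt i hi
    have h3 := (D ⟨i, hit⟩).2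
    simp only [he]
    omega
  have hmem : ∀ b ∈ List.ofFn (fun j : Fin n => e j), 0 < b ∧ b ≤ Δ := by
    intro b hb
    obtain ⟨j, rfl⟩ := (List.mem_ofFn' _ _).1 hb
    exact hpos j j.2
  let c : Composition t := ⟨List.ofFn fun j : Fin n => e j, fun {b} hb => (hmem b hb).1, by
    rw [List.sum_ofFn, Fin.sum_univ_eq_sum_range, hsum]; omega⟩
  refine ⟨c, fun b hb => (hmem b hb).2, funext fun k => ?_⟩
  have hlen : c.length = n := by simp [c, Composition.length]
  have hsize : ∀ i ≤ n, c.sizeUpTo i = min (switchTime D i) t := fun i hi => by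
    rw [← hsum]
    exact sum_take_ofFn e i hi
  have hi : (c.index k : ℕ) < n := hlen ▸ (c.index k).2
  have h1 := c.sizeUpTo_index_le k
  have h2 : (k : ℕ) < c.sizeUpTo (c.index k + 1) := c.lt_sizeUpTo_index_succ k
  rw [hsize _ hi.le] at h1
  rw [hsize (_ + 1) hi] at h2
  have h3 := hlt _ hi
  exact (hD ⟨c.index k, by omega⟩ k (by simp; omega) (by simp; omega)).symm

theorem feasible_eq_image {Δ t : ℕ} (p : Fin 2 → Fin Δ → ℝ) (hp : ∀ m d, 0 < p m d) :
    feasible p t =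
      (Finset.univ.filter fun c : Composition t => ∀ b ∈ c.blocks, b ≤ Δ).image compSeq := by
  ext s
  simp only [Finset.mem_image, Finset.mem_filter, Finset.mem_univ, true_and]
  constructor
  · exact exists_compSeq_of_mem_feasible p
  · rintro ⟨c, hc, rfl⟩
    exact compSeq_mem_feasible p hp c hc

/-! ### Renewal recursion for weighted sums -/

/-- The lists of integers in `{1, …, Δ}` that sum to `t`. -/
def boundedLists (Δ : ℕ) : ℕ → Finset (List ℕ)
  | 0 => {[]}
  | t + 1 => Finset.univ.biUnion fun d : Fin Δ =>
      if (d : ℕ) ≤ t then (boundedLists Δ (t - d)).image (List.cons (d + 1)) else ∅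

theorem mem_boundedLists {Δ : ℕ} (t : ℕ) (L : List ℕ) :
    L ∈ boundedLists Δ t ↔ L.sum = t ∧ ∀ b ∈ L, 1 ≤ b ∧ b ≤ Δ := by
  induction t using Nat.strong_induction_on generalizing L with
  | _ t ih =>
    cases t with
    | zero =>
      rw [boundedLists, Finset.mem_singleton]
      constructor
      · rintro rfl; simp
      · rintro ⟨h1, h2⟩
        cases L with
        | nil => rfl
        | cons b L =>
          have := h2 b (by simp)
          simp only [List.sum_cons] at h1
          omega
    | succ t =>
      rw [boundedLists]
      simp only [Finset.mem_biUnion, Finset.mem_univ, true_and]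
      constructor
      · rintro ⟨d, hd⟩
        split_ifs at hd with h
        · obtain ⟨L', hL', rfl⟩ := Finset.mem_image.1 hd
          rw [ih _ (by omega)] at hL'
          have := d.2
          refine ⟨by simp only [List.sum_cons]; omega, fun b hb => ?_⟩
          rcases List.mem_cons.1 hb with rfl | hb
          · omega
          · exact hL'.2 b hb
        · simp at hd
      · rintro ⟨h1, h2⟩
        cases L with
        | nil => simp at h1
        | cons b L =>
          have hb := h2 b (by simp)
          simp only [List.sum_cons] at h1
          refine ⟨⟨b - 1, by omega⟩, ?_⟩
          simp only
          rw [if_pos (by omega), Finset.mem_image]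
          refine ⟨L, ?_, by rw [Nat.sub_add_cancel hb.1]⟩
          rw [ih _ (by omega)]
          exact ⟨by omega, fun b hb => h2 b (by simp [hb])⟩

/-- The product of the weights `f m b` of the phases of a state sequence whose phase lengths are
the given list, the first phase having index `j`. -/
def listWeight (f : Fin 2 → ℕ → ℝ) : ℕ → List ℕ → ℝ
  | _, [] => 1
  | j, b :: L => f (phaseState j) b * listWeight f (j + 1) L

theorem listWeight_eq_prod (f : Fin 2 → ℕ → ℝ) (j : ℕ) (L : List ℕ) :
    listWeight f j L = ∏ i : Fin L.length, f (phaseState (j + i)) (L.get i) := by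
  induction L generalizing j with
  | nil => simp [listWeight]
  | cons b L ih =>
    rw [listWeight, ih]
    simp only [List.length_cons]
    rw [Fin.prod_univ_succ]
    simp [add_assoc, add_comm 1]

theorem sum_listWeight_succ {Δ : ℕ} (f : Fin 2 → ℕ → ℝ) (j t : ℕ) :
    ∑ L ∈ boundedLists Δ (t + 1), listWeight f j L =
      ∑ d : Fin Δ, if (d : ℕ) ≤ t then
        f (phaseState j) (d + 1) * ∑ L ∈ boundedLists Δ (t - d), listWeight f (j + 1) L else 0 := by
  rw [boundedLists, Finset.sum_biUnion]
  · refine Finset.sum_congr rfl fun d _ => ?_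
    split_ifs
    · rw [Finset.sum_image (by intro L _ L' _ h; exact (List.cons.inj h).2), Finset.mul_sum]
      rfl
    · simp
  · intro d _ d' _ hdd'
    rw [Function.onFun, Finset.disjoint_left]
    intro L hL hL'
    split_ifs at hL hL' <;> simp only [Finset.mem_image, Finset.notMem_empty] at hL hL'
    obtain ⟨L1, -, rfl⟩ := hL
    obtain ⟨L2, -, h⟩ := hL'
    have := (List.cons.inj h).1
    exact hdd' (Fin.ext (by omega))

/-- The sum is the probability that `t` is a renewal epoch. Conditioning on the first phase
expresses it as a subaverage of its values at earlier times. -/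
theorem sum_listWeight_le_one {Δ : ℕ} (f : Fin 2 → ℕ → ℝ) (hf : ∀ m b, 0 ≤ f m b)
    (hsum : ∀ m, ∑ d : Fin Δ, f m (d + 1) = 1) (j t : ℕ) :
    ∑ L ∈ boundedLists Δ t, listWeight f j L ≤ 1 := by
  induction t using Nat.strong_induction_on generalizing j with
  | _ t ih =>
    cases t with
    | zero => simp [boundedLists, listWeight]
    | succ t =>
      rw [sum_listWeight_succ, ← hsum (phaseState j)]
      refine Finset.sum_le_sum fun d _ => ?_
      split_ifs
      · exact mul_le_of_le_one_right (hf _ _) (ih _ (by omega) _)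
      · exact hf _ _

/-- At positive times up to `Δ` a single phase can fill the whole time, with weight at least `κ`;
later values are averages of earlier ones. This uniform bound makes the renewal theorem unnecessary.
-/
theorem le_sum_listWeight {Δ : ℕ} (f : Fin 2 → ℕ → ℝ) (hf : ∀ m b, 0 ≤ f m b)
    (hsum : ∀ m, ∑ d : Fin Δ, f m (d + 1) = 1) (κ : ℝ) (hκ0 : 0 ≤ κ) (hκ1 : κ ≤ 1)
    (hκ : ∀ m, ∀ d : Fin Δ, κ ≤ f m (d + 1)) (j t : ℕ) :
    κ ≤ ∑ L ∈ boundedLists Δ t, listWeight f j L := by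
  induction t using Nat.strong_induction_on generalizing j with
  | _ t ih =>
    cases t with
    | zero => simpa [boundedLists, listWeight] using hκ1
    | succ t =>
      rw [sum_listWeight_succ]
      have hnn : ∀ d : Fin Δ, 0 ≤ if (d : ℕ) ≤ t then f (phaseState j) (d + 1) *
          ∑ L ∈ boundedLists Δ (t - d), listWeight f (j + 1) L else 0 := fun d => by
        split_ifs
        · exact mul_nonneg (hf _ _) (hκ0.trans (ih _ (by omega) _))
        · rfl
      by_cases ht : t < Δ
      · refine le_trans ?_ (Finset.single_le_sum (fun d _ => hnn d) (Finset.mem_univ ⟨t, ht⟩))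
        simpa [boundedLists, listWeight] using hκ (phaseState j) ⟨t, ht⟩
      · calc κ = ∑ d : Fin Δ, f (phaseState j) (d + 1) * κ := by
              rw [← Finset.sum_mul, hsum, one_mul]
          _ ≤ _ := by
              refine Finset.sum_le_sum fun d _ => ?_
              rw [if_pos (by omega)]
              exact mul_le_mul_of_nonneg_left (ih _ (by omega) _) (hf _ _)

/-! ### Weights as functions of the phase counts -/

/-- The weight of a state sequence whose state-`m` phases of length `d + 1` have weight `π m d`. -/
def seqWeight {Δ t : ℕ} (π : Fin 2 → Fin Δ → ℝ) (s : Fin t → Fin 2) : ℝ :=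
  ∏ m, ∏ d : Fin Δ, π m d ^ phaseCount s m (d + 1)

/-- The extension of a function of durations by zero. -/
def extendZero {Δ : ℕ} (g : Fin 2 → Fin Δ → ℝ) (m : Fin 2) (b : ℕ) : ℝ :=
  if h : b - 1 < Δ then g m ⟨b - 1, h⟩ else 0

theorem extendZero_succ {Δ : ℕ} (g : Fin 2 → Fin Δ → ℝ) (m : Fin 2) (d : Fin Δ) :
    extendZero g m (d + 1) = g m d := by
  simp [extendZero]

/-- The index in `Fin Δ` of a block of a composition with blocks in `{1, …, Δ}`. -/
def blockIndex {Δ t : ℕ} (c : Composition t) (hc : ∀ b ∈ c.blocks, b ≤ Δ) (i : Fin c.length) :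
    Fin Δ :=
  ⟨c.blocksFun i - 1, by
    have := hc _ (c.blocksFun_mem_blocks i)
    have := c.one_le_blocksFun i
    omega⟩

theorem blockIndex_add_one {Δ t : ℕ} (c : Composition t) (hc : ∀ b ∈ c.blocks, b ≤ Δ)
    (i : Fin c.length) : (blockIndex c hc i : ℕ) + 1 = c.blocksFun i :=
  Nat.sub_add_cancel (c.one_le_blocksFun i)

theorem phaseCount_compSeq_eq {Δ t : ℕ} (c : Composition t) (hc : ∀ b ∈ c.blocks, b ≤ Δ)
    (m : Fin 2) (d : Fin Δ) :
    phaseCount (compSeq c) m (d + 1) = (Finset.univ.filter fun i : Fin c.length =>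
      (phaseState i, blockIndex c hc i) = (m, d)).card := by
  rw [phaseCount_compSeq c m _ (by omega)]
  congr 1
  ext i
  simp only [Finset.mem_filter, Finset.mem_univ, true_and, Prod.mk.injEq, Fin.ext_iff (a := blockIndex c hc i)]
  rw [← blockIndex_add_one c hc i]
  simp

theorem sum_phaseCount_compSeq {Δ t : ℕ} (c : Composition t) (hc : ∀ b ∈ c.blocks, b ≤ Δ)
    (m : Fin 2) (g : Fin Δ → ℝ) :
    ∑ d : Fin Δ, g d * phaseCount (compSeq c) m (d + 1) =
      ∑ i ∈ Finset.univ.filter (fun i : Fin c.length => phaseState i = m), g (blockIndex c hc i) := by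
  rw [← Finset.sum_fiberwise _ (fun i => blockIndex c hc i)]
  refine Finset.sum_congr rfl fun d _ => ?_
  rw [phaseCount_compSeq_eq c hc, Finset.filter_filter]
  rw [Finset.sum_congr rfl (g := fun _ => g d)]
  · simp [mul_comm]
  · intro i hi
    rw [(Finset.mem_filter.1 hi).2.2]

theorem seqWeight_compSeq {Δ t : ℕ} (π : Fin 2 → Fin Δ → ℝ) (c : Composition t)
    (hc : ∀ b ∈ c.blocks, b ≤ Δ) :
    seqWeight π (compSeq c) = listWeight (extendZero π) 0 c.blocks := by
  rw [listWeight_eq_prod]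
  have h1 : ∏ i : Fin c.blocks.length, extendZero π (phaseState (0 + i)) (c.blocks.get i) =
      ∏ i : Fin c.length, π (phaseState i) (blockIndex c hc i) := by
    refine Finset.prod_congr rfl fun i _ => ?_
    rw [zero_add, ← extendZero_succ π, blockIndex_add_one]
    rfl
  rw [h1, seqWeight, ← Finset.prod_product', Finset.univ_product_univ,
    ← Finset.prod_fiberwise Finset.univ (fun i : Fin c.length => (phaseState i, blockIndex c hc i))]
  refine Finset.prod_congr rfl fun x _ => ?_
  rw [phaseCount_compSeq_eq c hc]
  rw [Finset.prod_congr rfl (g := fun _ => π x.1 x.2)]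
  · simp
  · intro i hi
    have := (Finset.mem_filter.1 hi).2
    rw [← this]

theorem sum_feasible_seqWeight {Δ : ℕ} (p : Fin 2 → Fin Δ → ℝ) (hp : ∀ m d, 0 < p m d)
    (π : Fin 2 → Fin Δ → ℝ) (t : ℕ) :
    ∑ s ∈ feasible p t, seqWeight π s =
      ∑ L ∈ boundedLists Δ t, listWeight (extendZero π) 0 L := by
  rw [feasible_eq_image p hp, Finset.sum_image compSeq_injective.injOn]
  refine Finset.sum_nbij Composition.blocks (fun c hc => ?_) (fun c _ c' _ h => ?_)
    (fun L hL => ?_) (fun c hc => ?_)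
  · rw [mem_boundedLists]
    exact ⟨c.blocks_sum, fun b hb => ⟨c.one_le_blocks hb, (Finset.mem_filter.1 hc).2 b hb⟩⟩
  · exact Composition.ext h
  · rw [Finset.mem_coe, mem_boundedLists] at hL
    exact ⟨⟨L, fun {b} hb => (hL.2 b hb).1, hL.1⟩, by simpa using fun b hb => (hL.2 b hb).2, rfl⟩
  · exact seqWeight_compSeq π c (Finset.mem_filter.1 hc).2

theorem sum_feasible_seqWeight_le_one {Δ : ℕ} (p : Fin 2 → Fin Δ → ℝ) (hp : ∀ m d, 0 < p m d)
    (π : Fin 2 → Fin Δ → ℝ) (hπ : ∀ m d, 0 ≤ π m d) (hsum : ∀ m, ∑ d, π m d = 1) (t : ℕ) :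
    ∑ s ∈ feasible p t, seqWeight π s ≤ 1 := by
  rw [sum_feasible_seqWeight p hp]
  refine sum_listWeight_le_one _ (fun m b => ?_) (fun m => ?_) 0 t
  · unfold extendZero
    split_ifs
    · exact hπ _ _
    · rfl
  · simp_rw [extendZero_succ, hsum]

theorem exists_le_sum_feasible_seqWeight {Δ : ℕ} (p : Fin 2 → Fin Δ → ℝ) (hp : ∀ m d, 0 < p m d)
    (π : Fin 2 → Fin Δ → ℝ) (hπ : ∀ m d, 0 < π m d) (hsum : ∀ m, ∑ d, π m d = 1) :
    ∃ κ : ℝ, 0 < κ ∧ ∀ t, κ ≤ ∑ s ∈ feasible p t, seqWeight π s := by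
  have hle : ∀ m d, π m d ≤ 1 := fun m d => by
    rw [← hsum m]
    exact Finset.single_le_sum (fun d _ => (hπ m d).le) (Finset.mem_univ d)
  obtain ⟨κ, h0, h1, hκ⟩ : ∃ κ : ℝ, 0 < κ ∧ κ ≤ 1 ∧ ∀ m d, κ ≤ π m d := by
    -- Every weight is at most `1`, so the product of all of them is a positive lower bound for
    -- each.
    refine ⟨∏ m, ∏ d, π m d, Finset.prod_pos fun m _ => Finset.prod_pos fun d _ => hπ m d,
      Finset.prod_le_one (fun m _ => Finset.prod_nonneg fun d _ => (hπ m d).le) fun m _ =>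
        Finset.prod_le_one (fun d _ => (hπ m d).le) fun d _ => hle m d, fun m d => ?_⟩
    rw [← Finset.prod_product', Finset.univ_product_univ]
    rw [← Finset.mul_prod_erase Finset.univ _ (Finset.mem_univ (m, d))]
    exact mul_le_of_le_one_right (hπ m d).le
      (Finset.prod_le_one (fun x _ => (hπ _ _).le) fun x _ => hle _ _)
  refine ⟨κ, h0, fun t => ?_⟩
  rw [sum_feasible_seqWeight p hp]
  refine le_sum_listWeight _ (fun m b => ?_) (fun m => ?_) κ h0.le h1 (fun m d => ?_) 0 t
  · unfold extendZero
    split_ifs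
    · exact (hπ _ _).le
    · rfl
  · simp_rw [extendZero_succ, hsum]
  · rw [extendZero_succ]; exact hκ m d

/-! ### Constraints on the type of a feasible sequence -/

theorem card_fiber_index {t : ℕ} (c : Composition t) (i : Fin c.length) :
    (Finset.univ.filter fun k => c.index k = i).card = c.blocksFun i := by
  have : (Finset.univ.filter fun k => c.index k = i) =
      Finset.univ.map (c.embedding i).toEmbedding := by
    ext k
    simp only [Finset.mem_filter, Finset.mem_univ, true_and, Finset.mem_map]
    rw [eq_comm, ← c.mem_range_embedding_iff']
    rfl
  rw [this]
  simp

theorem card_state_compSeq {t : ℕ} (c : Composition t) (m : Fin 2) :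
    (Finset.univ.filter fun k => compSeq c k = m).card =
      ∑ i ∈ Finset.univ.filter (fun i : Fin c.length => phaseState i = m), c.blocksFun i := by
  classical
  rw [Finset.card_eq_sum_card_fiberwise (f := c.index) (t := Finset.univ.filter fun i : Fin c.length => phaseState i = m)
    (fun k hk => by
      have := (Finset.mem_filter.1 hk).2
      simpa [compSeq] using this)]
  refine Finset.sum_congr rfl fun i hi => ?_
  rw [← card_fiber_index, Finset.filter_filter]
  congr 1
  ext k
  simp only [Finset.mem_filter, Finset.mem_univ, true_and, and_iff_right_iff_imp]
  rintro rfl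
  simpa [compSeq] using hi

theorem qDot_seqType {Δ t : ℕ} (p : Fin 2 → Fin Δ → ℝ) {s : Fin t → Fin 2}
    (hs : s ∈ feasible p t) (m : Fin 2) :
    qDot (seqType Δ s m) = ((Finset.univ.filter fun k => s k = m).card : ℝ) / t := by
  obtain ⟨c, hc, rfl⟩ := exists_compSeq_of_mem_feasible p hs
  rw [card_state_compSeq, qDot]
  simp only [seqType, ← mul_div_assoc]
  rw [← Finset.sum_div, sum_phaseCount_compSeq c hc]
  congr 1
  push_cast
  refine Finset.sum_congr rfl fun i _ => ?_
  rw [← blockIndex_add_one c hc i]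
  push_cast
  rfl

theorem fracState2_eq_qDot {Δ t : ℕ} (p : Fin 2 → Fin Δ → ℝ) {s : Fin t → Fin 2}
    (hs : s ∈ feasible p t) : fracState2 s = qDot (seqType Δ s 1) :=
  (qDot_seqType p hs 1).symm

theorem qDot_seqType_add {Δ t : ℕ} (ht : 1 ≤ t) (p : Fin 2 → Fin Δ → ℝ) {s : Fin t → Fin 2}
    (hs : s ∈ feasible p t) : qDot (seqType Δ s 0) + qDot (seqType Δ s 1) = 1 := by
  rw [qDot_seqType p hs, qDot_seqType p hs, ← add_div, ← Nat.cast_add]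
  have h : (Finset.univ.filter fun k => s k = 1) = Finset.univ.filter fun k => ¬ s k = 0 := by
    ext k
    simp only [Finset.mem_filter, Finset.mem_univ, true_and]
    omega
  rw [h, Finset.card_filter_add_card_filter_not, Finset.card_univ, Fintype.card_fin]
  exact div_self (by positivity)

theorem sum_phaseState_sign (n : ℕ) :
    (∑ i ∈ Finset.range n, if phaseState i = 0 then (1 : ℝ) else -1) = if Even n then 0 else 1 := by
  induction n with
  | zero => simp
  | succ n ih =>
    rw [Finset.sum_range_succ, ih]
    by_cases h : Even n <;> simp [Nat.even_add_one, h, phaseState]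

/-- Phases alternate, so the two numbers of phases differ by at most one. The balance condition in
`typeSet` therefore holds only in the limit, whereas the duration condition is exact. -/
theorem abs_sum_seqType_sub_le {Δ t : ℕ} (p : Fin 2 → Fin Δ → ℝ) {s : Fin t → Fin 2}
    (hs : s ∈ feasible p t) : |∑ d, seqType Δ s 0 d - ∑ d, seqType Δ s 1 d| ≤ 1 / t := by
  obtain ⟨c, hc, rfl⟩ := exists_compSeq_of_mem_feasible p hs
  have h : ∀ m, ∑ d, seqType Δ (compSeq c) m d =
      (∑ i : Fin c.length, if phaseState i = m then (1 : ℝ) else 0) / t := fun m => by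
    have := sum_phaseCount_compSeq c hc m (fun _ => 1)
    simp only [one_mul] at this
    simp only [seqType]
    rw [← Finset.sum_div, this, Finset.sum_filter]
  rw [h, h, ← sub_div, ← Finset.sum_sub_distrib, abs_div, abs_of_nonneg (Nat.cast_nonneg (α := ℝ) t)]
  gcongr
  have : ∀ i : Fin c.length, ((if phaseState i = 0 then (1 : ℝ) else 0) -
      if phaseState i = 1 then (1 : ℝ) else 0) = if phaseState i = 0 then (1 : ℝ) else -1 := by
    intro i
    unfold phaseState
    by_cases h : Even (i : ℕ) <;> simp [h]
  simp_rw [this]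
  rw [Fin.sum_univ_eq_sum_range (fun i => if phaseState i = 0 then (1 : ℝ) else -1),
    sum_phaseState_sign]
  split_ifs <;> simp

theorem seqType_nonneg {Δ t : ℕ} (s : Fin t → Fin 2) (m : Fin 2) (d : Fin Δ) :
    0 ≤ seqType Δ s m d := by
  unfold seqType; positivity

theorem seqType_le_one {Δ t : ℕ} (ht : 1 ≤ t) (s : Fin t → Fin 2) (m : Fin 2) (d : Fin Δ) :
    seqType Δ s m d ≤ 1 := by
  have : (0 : ℝ) < t := by exact_mod_cast ht
  rw [seqType, div_le_one this]
  refine Nat.cast_le.2 ?_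
  classical
  rw [phaseCount]
  exact (Finset.card_filter_le _ _).trans (Finset.card_range t).le

/-! ### Entropy and the Gibbs inequality on the set of types -/

theorem eventually_le_exp_mul (C : ℝ) {c : ℝ} (hc : 0 < c) :
    ∀ᶠ t : ℕ in atTop, C ≤ Real.exp (t * c) :=
  (Real.tendsto_exp_atTop.comp
    (tendsto_natCast_atTop_atTop.atTop_mul_const hc)).eventually_ge_atTop C

/-- The linear functional `∑ ν m d * log (π m d)`. -/
def logWeight {Δ : ℕ} (π ν : Fin 2 → Fin Δ → ℝ) : ℝ := ∑ m, ∑ d, ν m d * Real.log (π m d)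

theorem continuous_logWeight {Δ : ℕ} (π : Fin 2 → Fin Δ → ℝ) : Continuous (logWeight π) := by
  unfold logWeight; fun_prop

theorem seqWeight_pos {Δ t : ℕ} (π : Fin 2 → Fin Δ → ℝ) (hπ : ∀ m d, 0 < π m d)
    (s : Fin t → Fin 2) : 0 < seqWeight π s :=
  Finset.prod_pos fun m _ => Finset.prod_pos fun d _ => pow_pos (hπ m d) _

theorem seqWeight_eq_exp {Δ t : ℕ} (ht : 1 ≤ t) (π : Fin 2 → Fin Δ → ℝ) (hπ : ∀ m d, 0 < π m d)
    (s : Fin t → Fin 2) : seqWeight π s = Real.exp (t * logWeight π (seqType Δ s)) := by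
  have ht' : (t : ℝ) ≠ 0 := by positivity
  rw [← Real.exp_log (seqWeight_pos π hπ s), seqWeight,
    Real.log_prod (fun m _ => (Finset.prod_pos fun d _ => pow_pos (hπ m d) _).ne')]
  congr 1
  rw [logWeight, Finset.mul_sum]
  refine Finset.sum_congr rfl fun m _ => ?_
  rw [Real.log_prod (fun d _ => (pow_pos (hπ m d) _).ne'), Finset.mul_sum]
  refine Finset.sum_congr rfl fun d _ => ?_
  rw [Real.log_pow, seqType]
  field_simp

/-- Both `x log x` terms are continuous at `0`, so this form gives continuity of the entropy up to
the boundary of the orthant. -/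
theorem entropy_eq {Δ : ℕ} (l : Fin Δ → ℝ) (hl : ∀ d, 0 ≤ l d) :
    entropy l = ∑ d, Real.negMulLog (l d) + (∑ d, l d) * Real.log (∑ d, l d) := by
  rw [entropy, Finset.sum_mul, ← Finset.sum_add_distrib, ← Finset.sum_neg_distrib]
  refine Finset.sum_congr rfl fun d _ => ?_
  rcases (hl d).eq_or_lt with h | h
  · simp [← h]
  · have : 0 < ∑ e, l e :=
      h.trans_le (Finset.single_le_sum (fun e _ => hl e) (Finset.mem_univ d))
    rw [Real.log_div h.ne' this.ne', Real.negMulLog]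
    ring

/-- The growth rate of the number of sequences of type `ν`. -/
def totalEntropy {Δ : ℕ} (ν : Fin 2 → Fin Δ → ℝ) : ℝ := entropy (ν 0) + entropy (ν 1)

theorem continuous_qDot {Δ : ℕ} : Continuous (qDot : (Fin Δ → ℝ) → ℝ) := by
  unfold qDot; fun_prop

theorem sum_le_qDot {Δ : ℕ} (l : Fin Δ → ℝ) (hl : ∀ d, 0 ≤ l d) : ∑ d, l d ≤ qDot l :=
  Finset.sum_le_sum fun d _ => le_mul_of_one_le_left (hl d) (by simp)

theorem qDot_le_mul_sum {Δ : ℕ} (l : Fin Δ → ℝ) (hl : ∀ d, 0 ≤ l d) :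
    qDot l ≤ Δ * ∑ d, l d := by
  rw [Finset.mul_sum]
  refine Finset.sum_le_sum fun d _ => mul_le_mul_of_nonneg_right ?_ (hl d)
  exact_mod_cast d.2

/-- If one state had no phases, by balance neither would have any, and the total duration could not
be `1`. This keeps the normalization of `ν m` and the denominator of `gaussRate` away from zero. -/
theorem sum_pos_of_mem_typeSet {Δ : ℕ} {ν : Fin 2 → Fin Δ → ℝ} (hν : ν ∈ typeSet Δ) (m : Fin 2) :
    0 < ∑ d, ν m d := by
  obtain ⟨h0, h1, h2⟩ := hν
  have h3 := qDot_le_mul_sum _ (h0 0)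
  have h4 := qDot_le_mul_sum _ (h0 1)
  have h5 : 0 ≤ ∑ d, ν 0 d := Finset.sum_nonneg fun d _ => h0 0 d
  have key : 0 < ∑ d, ν 0 d := by
    rcases h5.eq_or_lt with h | h
    · rw [← h1, ← h] at h4
      rw [← h] at h3
      linarith
    · exact h
  fin_cases m
  · exact key
  · exact h1 ▸ key

theorem qDot_pos_of_mem_typeSet {Δ : ℕ} {ν : Fin 2 → Fin Δ → ℝ} (hν : ν ∈ typeSet Δ) (m : Fin 2) :
    0 < qDot (ν m) :=
  (sum_pos_of_mem_typeSet hν m).trans_le (sum_le_qDot _ (hν.1 m))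

theorem sum_le_one_of_mem_typeSet {Δ : ℕ} {ν : Fin 2 → Fin Δ → ℝ} (hν : ν ∈ typeSet Δ)
    (m : Fin 2) : ∑ d, ν m d ≤ 1 := by
  have h0 := sum_le_qDot _ (hν.1 m)
  have h1 := qDot_pos_of_mem_typeSet hν 0
  have h2 := qDot_pos_of_mem_typeSet hν 1
  have h3 := hν.2.2
  fin_cases m <;> simp only [Fin.zero_eta, Fin.mk_one] at * <;> linarith

theorem isClosed_typeSet (Δ : ℕ) : IsClosed (typeSet Δ) := by
  have h : typeSet Δ = (⋂ m, ⋂ d, {ν | 0 ≤ ν m d}) ∩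
      ({ν | ∑ d, ν 0 d = ∑ d, ν 1 d} ∩ {ν | qDot (ν 0) + qDot (ν 1) = 1}) := by
    ext ν; simp [typeSet]
  rw [h]
  refine (isClosed_iInter fun m => isClosed_iInter fun d => ?_).inter (IsClosed.inter ?_ ?_)
  · exact isClosed_le continuous_const (by fun_prop)
  · exact isClosed_eq (by fun_prop) (by fun_prop)
  · exact isClosed_eq ((continuous_qDot.comp (continuous_apply 0)).add
      (continuous_qDot.comp (continuous_apply 1))) continuous_const

theorem continuousOn_totalEntropy (Δ : ℕ) : ContinuousOn (totalEntropy (Δ := Δ)) (typeSet Δ) := by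
  have h1 : Continuous fun l : Fin Δ → ℝ =>
      ∑ d, Real.negMulLog (l d) + (∑ d, l d) * Real.log (∑ d, l d) := by
    refine (continuous_finsetSum _ fun d _ =>
      Real.continuous_negMulLog.comp (continuous_apply d)).add ?_
    exact Real.continuous_mul_log.comp (continuous_finsetSum _ fun d _ => continuous_apply d)
  refine ((h1.comp (continuous_apply (0 : Fin 2))).add
    (h1.comp (continuous_apply (1 : Fin 2)))).continuousOn.congr fun ν hν => ?_
  rw [totalEntropy, entropy_eq _ (hν.1 0), entropy_eq _ (hν.1 1)]
  rfl

/-- This is `log x ≤ x - 1` at `x = b / a`, the coordinatewise form of the Gibbs inequality. -/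
theorem mul_log_sub_le {a b : ℝ} (ha : 0 ≤ a) (hb : 0 < b) :
    a * Real.log b - a * Real.log a ≤ b - a := by
  rcases ha.eq_or_lt with h | h
  · simp [← h, hb.le]
  · have h1 := Real.log_le_sub_one_of_pos (div_pos hb h)
    rw [Real.log_div hb.ne' h.ne'] at h1
    have h2 := mul_le_mul_of_nonneg_left h1 ha
    have h3 : a * (b / a - 1) = b - a := by field_simp
    linarith

theorem mul_log_sub_lt {a b : ℝ} (ha : 0 ≤ a) (hb : 0 < b) (hab : a ≠ b) :
    a * Real.log b - a * Real.log a < b - a := by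
  rcases ha.eq_or_lt with h | h
  · simp [← h, hb]
  · have h1 := Real.log_lt_sub_one_of_pos (div_pos hb h)
      (fun h' => hab ((div_eq_one_iff_eq h.ne').1 h').symm)
    rw [Real.log_div hb.ne' h.ne'] at h1
    have h2 := mul_lt_mul_of_pos_left h1 h
    have h3 : a * (b / a - 1) = b - a := by field_simp
    linarith

/-- The right side is minus the relative entropy of `l` with respect to `(∑ l) π`. The two vectors
have equal mass when `π` sums to one, so the bounds `b - a` of the coordinates then cancel. -/
theorem entropy_add_sum_mul_log {Δ : ℕ} (l π : Fin Δ → ℝ) (hl : ∀ d, 0 ≤ l d)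
    (hS : 0 < ∑ d, l d) (hπ : ∀ d, 0 < π d) :
    entropy l + ∑ d, l d * Real.log (π d) =
      ∑ d, (l d * Real.log ((∑ e, l e) * π d) - l d * Real.log (l d)) := by
  rw [entropy_eq l hl, Finset.sum_mul, ← Finset.sum_add_distrib, ← Finset.sum_add_distrib]
  refine Finset.sum_congr rfl fun d _ => ?_
  rw [Real.log_mul hS.ne' (hπ d).ne', Real.negMulLog]
  ring

theorem sum_mul_sub_eq_zero {Δ : ℕ} (l π : Fin Δ → ℝ) (hsum : ∑ d, π d = 1) :
    ∑ d, ((∑ e, l e) * π d - l d) = 0 := by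
  rw [Finset.sum_sub_distrib, ← Finset.mul_sum, hsum]
  ring

theorem entropy_add_sum_mul_log_nonpos {Δ : ℕ} (l π : Fin Δ → ℝ) (hl : ∀ d, 0 ≤ l d)
    (hS : 0 < ∑ d, l d) (hπ : ∀ d, 0 < π d) (hsum : ∑ d, π d = 1) :
    entropy l + ∑ d, l d * Real.log (π d) ≤ 0 := by
  rw [entropy_add_sum_mul_log l π hl hS hπ, ← sum_mul_sub_eq_zero l π hsum]
  exact Finset.sum_le_sum fun d _ => mul_log_sub_le (hl d) (mul_pos hS (hπ d))

theorem entropy_add_sum_mul_log_neg {Δ : ℕ} (l π : Fin Δ → ℝ) (hl : ∀ d, 0 ≤ l d)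
    (hS : 0 < ∑ d, l d) (hπ : ∀ d, 0 < π d) (hsum : ∑ d, π d = 1)
    (hne : ∃ d, l d ≠ (∑ e, l e) * π d) :
    entropy l + ∑ d, l d * Real.log (π d) < 0 := by
  obtain ⟨d, hd⟩ := hne
  rw [entropy_add_sum_mul_log l π hl hS hπ, ← sum_mul_sub_eq_zero l π hsum]
  exact Finset.sum_lt_sum (fun d _ => mul_log_sub_le (hl d) (mul_pos hS (hπ d)))
    ⟨d, Finset.mem_univ d, mul_log_sub_lt (hl d) (mul_pos hS (hπ d)) hd⟩

theorem totalEntropy_add_logWeight {Δ : ℕ} (ν π : Fin 2 → Fin Δ → ℝ) :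
    totalEntropy ν + logWeight π ν = (entropy (ν 0) + ∑ d, ν 0 d * Real.log (π 0 d)) +
      (entropy (ν 1) + ∑ d, ν 1 d * Real.log (π 1 d)) := by
  rw [totalEntropy, logWeight, Fin.sum_univ_two]; ring

theorem totalEntropy_add_logWeight_nonpos {Δ : ℕ} {ν π : Fin 2 → Fin Δ → ℝ} (hν : ν ∈ typeSet Δ)
    (hπ : ∀ m d, 0 < π m d) (hsum : ∀ m, ∑ d, π m d = 1) :
    totalEntropy ν + logWeight π ν ≤ 0 := by
  rw [totalEntropy_add_logWeight]
  have h := fun m => entropy_add_sum_mul_log_nonpos (ν m) (π m) (hν.1 m)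
    (sum_pos_of_mem_typeSet hν m) (hπ m) (hsum m)
  linarith [h 0, h 1]

theorem totalEntropy_add_logWeight_neg {Δ : ℕ} {ν π : Fin 2 → Fin Δ → ℝ} (hν : ν ∈ typeSet Δ)
    (hπ : ∀ m d, 0 < π m d) (hsum : ∀ m, ∑ d, π m d = 1)
    (hne : ∃ m d, ν m d ≠ (∑ e, ν m e) * π m d) :
    totalEntropy ν + logWeight π ν < 0 := by
  rw [totalEntropy_add_logWeight]
  have h := fun m => entropy_add_sum_mul_log_nonpos (ν m) (π m) (hν.1 m)
    (sum_pos_of_mem_typeSet hν m) (hπ m) (hsum m)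
  obtain ⟨m, hd⟩ := hne
  have h' := entropy_add_sum_mul_log_neg (ν m) (π m) (hν.1 m)
    (sum_pos_of_mem_typeSet hν m) (hπ m) (hsum m) hd
  have h0 := h 0
  have h1 := h 1
  fin_cases m <;> simp only [Fin.zero_eta, Fin.mk_one] at h' <;> linarith

/-! ### Counting sequences by type -/

open Classical in
/-- The feasible sequences of length `t` with type in `U`. -/
def typeClass {Δ : ℕ} (p : Fin 2 → Fin Δ → ℝ) (t : ℕ) (U : Set (Fin 2 → Fin Δ → ℝ)) :
    Finset (Fin t → Fin 2) :=
  (feasible p t).filter fun s => seqType Δ s ∈ U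

theorem mem_typeClass {Δ : ℕ} {p : Fin 2 → Fin Δ → ℝ} {t : ℕ} {U : Set (Fin 2 → Fin Δ → ℝ)}
    {s : Fin t → Fin 2} : s ∈ typeClass p t U ↔ s ∈ feasible p t ∧ seqType Δ s ∈ U := by
  classical
  rw [typeClass, Finset.mem_filter]

theorem typeClass_mono {Δ : ℕ} (p : Fin 2 → Fin Δ → ℝ) (t : ℕ) {U V : Set (Fin 2 → Fin Δ → ℝ)}
    (h : U ⊆ V) : typeClass p t U ⊆ typeClass p t V := fun s hs => by
  rw [mem_typeClass] at hs ⊢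
  exact ⟨hs.1, h hs.2⟩

/-- Upper bound on the number of sequences with type near a given one. -/
theorem exists_nhds_card_typeClass_le {Δ : ℕ} (p : Fin 2 → Fin Δ → ℝ) (hp : ∀ m d, 0 < p m d)
    {ν : Fin 2 → Fin Δ → ℝ} (hν : ν ∈ typeSet Δ) {ε : ℝ} (hε : 0 < ε) :
    ∃ U ∈ 𝓝 ν, ∀ t, 1 ≤ t →
      ((typeClass p t U).card : ℝ) ≤ Real.exp (t * (totalEntropy ν + ε)) := by
  have hΔ : (0 : ℝ) < Δ := by
    have h := sum_pos_of_mem_typeSet hν 0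
    rcases Nat.eq_zero_or_pos Δ with rfl | h'
    · simp at h
    · exact_mod_cast h'
  set r := Real.exp (-(ε / 4)) with hr
  have hr0 : 0 < r := Real.exp_pos _
  have hr1 : r < 1 := by rw [hr, Real.exp_lt_one_iff]; linarith
  -- The uniform part makes `π` positive even where `ν` vanishes. The factor `r = exp (-ε / 4)`
  -- costs at most `ε / 4` per state, since each `ν m` has mass at most `1`.
  set π : Fin 2 → Fin Δ → ℝ := fun m d => r * (ν m d / ∑ e, ν m e) + (1 - r) / Δ with hπdef
  have hq : ∀ m d, 0 ≤ ν m d / ∑ e, ν m e := fun m d =>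
    div_nonneg (hν.1 m d) (sum_pos_of_mem_typeSet hν m).le
  have hπ : ∀ m d, 0 < π m d := fun m d =>
    add_pos_of_nonneg_of_pos (mul_nonneg hr0.le (hq m d)) (div_pos (by linarith) hΔ)
  have hsum : ∀ m, ∑ d, π m d = 1 := fun m => by
    rw [hπdef, Finset.sum_add_distrib, ← Finset.mul_sum, ← Finset.sum_div,
      div_self (sum_pos_of_mem_typeSet hν m).ne']
    simp only [Finset.sum_const, Finset.card_univ, Fintype.card_fin, nsmul_eq_mul]
    field_simp
    ring
  have hone : ∀ m, -∑ d, ν m d * Real.log (π m d) ≤ entropy (ν m) + ε / 4 := fun m => by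
    have h1 : ∀ d, ν m d * (-(ε / 4)) + ν m d * Real.log (ν m d / ∑ e, ν m e) ≤
        ν m d * Real.log (π m d) := fun d => by
      rcases (hν.1 m d).eq_or_lt with h | h
      · simp [← h]
      · rw [← mul_add]
        refine mul_le_mul_of_nonneg_left ?_ h.le
        have h2 : 0 < ν m d / ∑ e, ν m e := div_pos h (sum_pos_of_mem_typeSet hν m)
        rw [show -(ε / 4) = Real.log r by rw [hr, Real.log_exp], ← Real.log_mul hr0.ne' h2.ne']
        refine Real.log_le_log (mul_pos hr0 h2) ?_
        have : 0 ≤ (1 - r) / Δ := div_nonneg (by linarith) hΔ.le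
        simp only [hπdef]; linarith
    have h2 := Finset.sum_le_sum fun d (_ : d ∈ Finset.univ) => h1 d
    rw [Finset.sum_add_distrib, ← Finset.sum_mul] at h2
    have h3 := sum_le_one_of_mem_typeSet hν m
    rw [entropy]
    nlinarith
  have hlw : -logWeight π ν < totalEntropy ν + ε := by
    rw [logWeight, Fin.sum_univ_two, totalEntropy]
    linarith [hone 0, hone 1]
  refine ⟨{V | -logWeight π V < totalEntropy ν + ε},
    (isOpen_lt (continuous_logWeight π).neg continuous_const).mem_nhds hlw, fun t ht => ?_⟩
  set G := typeClass p t {V | -logWeight π V < totalEntropy ν + ε} with hG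
  -- Each sequence in `G` weighs at least `exp (-t (totalEntropy ν + ε))`, and the total weight is
  -- at most `1`.
  have h1 : (G.card : ℝ) * Real.exp (-(t * (totalEntropy ν + ε))) ≤ 1 := by
    refine le_trans ?_ (sum_feasible_seqWeight_le_one p hp π (fun m d => (hπ m d).le) hsum t)
    rw [← nsmul_eq_mul]
    refine le_trans (Finset.card_nsmul_le_sum G (fun s => seqWeight π s) _ fun s hs => ?_)
      (Finset.sum_le_sum_of_subset_of_nonneg (fun s hs => (mem_typeClass.1 hs).1)
        fun s _ _ => (seqWeight_pos π hπ s).le)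
    rw [seqWeight_eq_exp ht π hπ, Real.exp_le_exp, ← mul_neg]
    have h2 : -logWeight π (seqType Δ s) < totalEntropy ν + ε := (mem_typeClass.1 hs).2
    exact mul_le_mul_of_nonneg_left (by linarith) (Nat.cast_nonneg t)
  rwa [Real.exp_neg, ← div_eq_mul_inv, div_le_one (Real.exp_pos _)] at h1

/-- No feasible sequences have types near a point outside the limiting set of types. -/
theorem exists_nhds_typeClass_eq_empty {Δ : ℕ} (p : Fin 2 → Fin Δ → ℝ)
    {ν : Fin 2 → Fin Δ → ℝ} (hν : ν ∉ typeSet Δ) :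
    ∃ U ∈ 𝓝 ν, ∀ᶠ t : ℕ in atTop, typeClass p t U = ∅ := by
  have hopen : ∀ (g : (Fin 2 → Fin Δ → ℝ) → ℝ) (_ : Continuous g) (a : ℝ), g ν ≠ a →
      {V | g V ≠ a} ∈ 𝓝 ν := fun g hg a h => (isOpen_ne_fun hg continuous_const).mem_nhds h
  by_cases h0 : ∀ m d, 0 ≤ ν m d
  swap
  · push Not at h0
    obtain ⟨m, d, h⟩ := h0
    refine ⟨{V | V m d < 0}, (isOpen_lt (by fun_prop) continuous_const).mem_nhds h,
      Eventually.of_forall fun t => Finset.eq_empty_of_forall_notMem fun s hs => ?_⟩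
    exact absurd (mem_typeClass.1 hs).2 (not_lt.2 (seqType_nonneg s m d))
  by_cases h2 : qDot (ν 0) + qDot (ν 1) = 1
  swap
  · refine ⟨_, hopen (fun V => qDot (V 0) + qDot (V 1)) ((continuous_qDot.comp (continuous_apply 0)).add
      (continuous_qDot.comp (continuous_apply 1))) 1 h2, ?_⟩
    filter_upwards [eventually_ge_atTop 1] with t ht
    refine Finset.eq_empty_of_forall_notMem fun s hs => ?_
    exact (mem_typeClass.1 hs).2 (qDot_seqType_add ht p (mem_typeClass.1 hs).1)
  have h1 : ∑ d, ν 0 d - ∑ d, ν 1 d ≠ 0 := fun h => hν ⟨h0, by linarith, h2⟩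
  have hpos := abs_pos.2 h1
  refine ⟨{V | |∑ d, ν 0 d - ∑ d, ν 1 d| / 2 < |∑ d, V 0 d - ∑ d, V 1 d|},
    (isOpen_lt continuous_const (by fun_prop)).mem_nhds (by simp only [Set.mem_ofPred_eq]; linarith),
    ?_⟩
  filter_upwards [tendsto_one_div_atTop_nhds_zero_nat.eventually_lt_const (half_pos hpos)] with t ht
  refine Finset.eq_empty_of_forall_notMem fun s hs => ?_
  have h3 : |∑ d, ν 0 d - ∑ d, ν 1 d| / 2 < |∑ d, seqType Δ s 0 d - ∑ d, seqType Δ s 1 d| :=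
    (mem_typeClass.1 hs).2
  have h4 := abs_sum_seqType_sub_le p (mem_typeClass.1 hs).1
  linarith

theorem sum_seqWeight_typeClass_union_le {Δ : ℕ} (p π : Fin 2 → Fin Δ → ℝ)
    (hπ : ∀ m d, 0 < π m d) (t : ℕ) (U V : Set (Fin 2 → Fin Δ → ℝ)) :
    ∑ s ∈ typeClass p t (U ∪ V), seqWeight π s ≤
      ∑ s ∈ typeClass p t U, seqWeight π s + ∑ s ∈ typeClass p t V, seqWeight π s := by
  classical
  have h : typeClass p t (U ∪ V) = typeClass p t U ∪ typeClass p t V := by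
    ext s; simp only [mem_typeClass, Finset.mem_union, Set.mem_union]; tauto
  rw [h, ← Finset.sum_union_inter]
  exact le_add_of_nonneg_right (Finset.sum_nonneg fun s _ => (seqWeight_pos π hπ s).le)

/-- Lower bound on the number of sequences with type near a positive type. -/
theorem eventually_le_card_typeClass_of_pos {Δ : ℕ} (p : Fin 2 → Fin Δ → ℝ)
    (hp : ∀ m d, 0 < p m d) {ν : Fin 2 → Fin Δ → ℝ} (hν : ν ∈ typeSet Δ)
    (hpos : ∀ m d, 0 < ν m d) {U : Set (Fin 2 → Fin Δ → ℝ)} (hU : U ∈ 𝓝 ν) {ε : ℝ} (hε : 0 < ε) :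
    ∀ᶠ t : ℕ in atTop, Real.exp (t * (totalEntropy ν - ε)) ≤ (typeClass p t U).card := by
  have hS := sum_pos_of_mem_typeSet hν
  set π : Fin 2 → Fin Δ → ℝ := fun m d => ν m d / ∑ e, ν m e with hπdef
  have hπ : ∀ m d, 0 < π m d := fun m d => div_pos (hpos m d) (hS m)
  have hsum : ∀ m, ∑ d, π m d = 1 := fun m => by
    rw [hπdef, ← Finset.sum_div, div_self (hS m).ne']
  have hlw : logWeight π ν = -totalEntropy ν := by
    rw [logWeight, Fin.sum_univ_two, totalEntropy, entropy, entropy]; ring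
  -- Equality in the Gibbs inequality makes `V` a multiple of `ν`, with the same factor for both
  -- states by balance; total duration `1` forces the factor to be `1`.
  have huniq : ∀ V ∈ typeSet Δ, V ≠ ν → totalEntropy V + logWeight π V < 0 := by
    intro V hV hne
    apply totalEntropy_add_logWeight_neg hV hπ hsum
    by_contra hall
    push Not at hall
    apply hne
    have hc : ∀ m d, V m d = (∑ e, V 0 e) / (∑ e, ν 0 e) * ν m d := fun m d => by
      have hm : ∀ m, (∑ e, V m e) / (∑ e, ν m e) = (∑ e, V 0 e) / (∑ e, ν 0 e) := by
        intro m
        fin_cases m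
        · rfl
        · simp only [Fin.mk_one]; rw [hV.2.1, hν.2.1]
      rw [← hm m]
      refine (hall m d).trans ?_
      simp only [hπdef]
      ring
    set a := (∑ e, V 0 e) / (∑ e, ν 0 e)
    have hq : ∀ m, qDot (V m) = a * qDot (ν m) := fun m => by
      rw [qDot, qDot, Finset.mul_sum]
      refine Finset.sum_congr rfl fun d _ => ?_
      rw [hc m d]; ring
    have ha : a = 1 := by
      have h1 := hV.2.2
      rw [hq, hq, ← mul_add, hν.2.2, mul_one] at h1
      exact h1
    ext m d
    rw [hc, ha, one_mul]
  obtain ⟨κ, hκ, hκle⟩ := exists_le_sum_feasible_seqWeight p hp π hπ hsum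
  -- Bounding the weight of each sequence from above on `U'` lets a lower bound on mass become a
  -- lower bound on cardinality.
  set U' := U ∩ {V | logWeight π V < -totalEntropy ν + ε / 2} with hU'
  have hU'n : U' ∈ 𝓝 ν := inter_mem hU
    ((isOpen_lt (continuous_logWeight π) continuous_const).mem_nhds
      (by simp only [Set.mem_ofPred_eq]; linarith))
  set K : Set (Fin 2 → Fin Δ → ℝ) := Set.Icc 0 1 \ interior U' with hK
  have hKc : IsCompact K := isCompact_Icc.diff isOpen_interior
  -- Exponential decay passes to subsets and finite unions, so on the compact `K` it suffices to
  -- check it near each point.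
  have hdecay : ∃ C : ℝ, 0 ≤ C ∧ ∃ c > 0, ∀ᶠ t : ℕ in atTop,
      ∑ s ∈ typeClass p t K, seqWeight π s ≤ C * Real.exp (-(t * c)) := by
    refine hKc.induction_on (p := fun A => ∃ C : ℝ, 0 ≤ C ∧ ∃ c > 0, ∀ᶠ t : ℕ in atTop,
      ∑ s ∈ typeClass p t A, seqWeight π s ≤ C * Real.exp (-(t * c))) ?_ ?_ ?_ ?_
    · refine ⟨0, le_rfl, 1, one_pos, Eventually.of_forall fun t => ?_⟩
      rw [Finset.sum_eq_zero]
      · simp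
      · intro s hs
        exact absurd (mem_typeClass.1 hs).2 (Set.notMem_empty _)
    · rintro A B hAB ⟨C, hC, c, hc, h⟩
      refine ⟨C, hC, c, hc, h.mono fun t ht => le_trans ?_ ht⟩
      exact Finset.sum_le_sum_of_subset_of_nonneg (typeClass_mono p t hAB)
        fun s _ _ => (seqWeight_pos π hπ s).le
    · rintro A B ⟨C, hC, c, hc, h⟩ ⟨C', hC', c', hc', h'⟩
      refine ⟨C + C', add_nonneg hC hC', min c c', lt_min hc hc', ?_⟩
      filter_upwards [h, h'] with t ht ht'
      refine (sum_seqWeight_typeClass_union_le p π hπ t A B).trans ?_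
      rw [add_mul]
      refine add_le_add (ht.trans ?_) (ht'.trans ?_)
      · gcongr; exact min_le_left _ _
      · gcongr; exact min_le_right _ _
    · intro V hV
      suffices h : ∃ A ∈ 𝓝 V, ∃ C : ℝ, 0 ≤ C ∧ ∃ c > 0, ∀ᶠ t : ℕ in atTop,
          ∑ s ∈ typeClass p t A, seqWeight π s ≤ C * Real.exp (-(t * c)) by
        obtain ⟨A, hA, h⟩ := h
        exact ⟨A, mem_nhdsWithin_of_mem_nhds hA, h⟩
      by_cases hVt : V ∈ typeSet Δ
      · have hne : V ≠ ν := by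
          rintro rfl
          exact hV.2 (mem_interior_iff_mem_nhds.2 hU'n)
        have hneg := huniq V hVt hne
        -- The gap `g` is split in three: one third is lost on the count, one on the weight, and the
        -- last is the decay rate.
        set g := -(totalEntropy V + logWeight π V) with hg
        have hg0 : 0 < g := by linarith
        obtain ⟨A, hA, hcard⟩ := exists_nhds_card_typeClass_le p hp hVt
          (ε := g / 3) (by linarith)
        refine ⟨A ∩ {W | logWeight π W < logWeight π V + g / 3}, inter_mem hA
          ((isOpen_lt (continuous_logWeight π) continuous_const).mem_nhds
            (by simp only [Set.mem_ofPred_eq]; linarith)), 1, zero_le_one, g / 3, by linarith, ?_⟩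
        filter_upwards [eventually_ge_atTop 1] with t ht
        have ht0 : (0 : ℝ) ≤ t := Nat.cast_nonneg t
        calc ∑ s ∈ typeClass p t (A ∩ {W | logWeight π W < logWeight π V + g / 3}), seqWeight π s
            ≤ (typeClass p t (A ∩ {W | logWeight π W < logWeight π V + g / 3})).card •
                Real.exp (t * (logWeight π V + g / 3)) := by
              refine Finset.sum_le_card_nsmul _ _ _ fun s hs => ?_
              rw [seqWeight_eq_exp ht π hπ, Real.exp_le_exp]
              exact mul_le_mul_of_nonneg_left (le_of_lt (mem_typeClass.1 hs).2.2) ht0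
          _ ≤ Real.exp (t * (totalEntropy V + g / 3)) *
                Real.exp (t * (logWeight π V + g / 3)) := by
              rw [nsmul_eq_mul]
              refine mul_le_mul_of_nonneg_right (le_trans ?_ (hcard t ht)) (Real.exp_pos _).le
              exact_mod_cast Finset.card_le_card (typeClass_mono p t Set.inter_subset_left)
          _ = 1 * Real.exp (-(t * (g / 3))) := by
              rw [← Real.exp_add, one_mul]
              congr 1
              rw [hg]; ring
      · obtain ⟨A, hA, hemp⟩ := exists_nhds_typeClass_eq_empty p hVt
        refine ⟨A, hA, 0, le_rfl, 1, one_pos, hemp.mono fun t ht => ?_⟩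
        simp [ht]
  obtain ⟨C, hC, c, hc, hdec⟩ := hdecay
  filter_upwards [hdec, eventually_ge_atTop 1, eventually_le_exp_mul (2 * C / κ) hc,
    eventually_le_exp_mul (2 / κ) (half_pos hε)] with t ht ht1 hCt hεt
  have ht0 : (0 : ℝ) ≤ t := Nat.cast_nonneg t
  have hmassK : ∑ s ∈ typeClass p t K, seqWeight π s ≤ κ / 2 := by
    refine ht.trans ?_
    rw [Real.exp_neg, ← div_eq_mul_inv, div_le_iff₀ (Real.exp_pos _)]
    rw [div_le_iff₀ hκ] at hCt
    linarith
  have hsplit : ∑ s ∈ feasible p t, seqWeight π s ≤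
      ∑ s ∈ typeClass p t U', seqWeight π s + ∑ s ∈ typeClass p t K, seqWeight π s := by
    refine le_trans ?_ (sum_seqWeight_typeClass_union_le p π hπ t U' K)
    refine Finset.sum_le_sum_of_subset_of_nonneg (fun s hs => mem_typeClass.2 ⟨hs, ?_⟩)
      fun s _ _ => (seqWeight_pos π hπ s).le
    by_cases h : seqType Δ s ∈ interior U'
    · exact Or.inl (interior_subset h)
    · exact Or.inr ⟨⟨fun m d => seqType_nonneg s m d, fun m d => seqType_le_one ht1 s m d⟩, h⟩
  have hmass : κ / 2 ≤ ∑ s ∈ typeClass p t U', seqWeight π s := by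
    linarith [hκle t]
  have hup : ∑ s ∈ typeClass p t U', seqWeight π s ≤
      (typeClass p t U).card * Real.exp (t * (-totalEntropy ν + ε / 2)) := by
    rw [← nsmul_eq_mul]
    refine (Finset.sum_le_card_nsmul _ _ _ fun s hs => ?_).trans
      (nsmul_le_nsmul_left (Real.exp_pos _).le
        (Finset.card_le_card (typeClass_mono p t Set.inter_subset_left)))
    rw [seqWeight_eq_exp ht1 π hπ, Real.exp_le_exp]
    exact mul_le_mul_of_nonneg_left (le_of_lt (mem_typeClass.1 hs).2.2) ht0
  have h1 : κ / 2 ≤ (typeClass p t U).card * Real.exp (t * (-totalEntropy ν + ε / 2)) :=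
    hmass.trans hup
  have h2 : 1 ≤ κ / 2 * Real.exp (t * (ε / 2)) := by
    rw [div_le_iff₀ hκ] at hεt
    linarith
  have h3 : Real.exp (t * (totalEntropy ν - ε)) * Real.exp (t * (ε / 2)) *
      Real.exp (t * (-totalEntropy ν + ε / 2)) = 1 := by
    rw [← Real.exp_add, ← Real.exp_add, Real.exp_eq_one_iff]; ring
  have h4 : 1 ≤ (typeClass p t U).card * Real.exp (t * (-totalEntropy ν + ε / 2)) *
      Real.exp (t * (ε / 2)) := h2.trans (mul_le_mul_of_nonneg_right h1 (Real.exp_pos _).le)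
  have h5 : 0 < Real.exp (t * (ε / 2)) * Real.exp (t * (-totalEntropy ν + ε / 2)) := by positivity
  refine le_of_mul_le_mul_right ?_ h5
  rw [← mul_assoc, h3]
  linarith

/-- The set of types is convex and contains a strictly positive point. Moving slightly from `ν`
towards it makes all coordinates positive, and the entropy is continuous. -/
theorem exists_pos_mem_typeSet_near {Δ : ℕ} {ν : Fin 2 → Fin Δ → ℝ} (hν : ν ∈ typeSet Δ)
    {U : Set (Fin 2 → Fin Δ → ℝ)} (hU : U ∈ 𝓝 ν) {ε : ℝ} (hε : 0 < ε) :
    ∃ ν' ∈ typeSet Δ, (∀ m d, 0 < ν' m d) ∧ U ∈ 𝓝 ν' ∧ totalEntropy ν - ε < totalEntropy ν' := by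
  have hΔ : 0 < Δ := by
    have h := sum_pos_of_mem_typeSet hν 0
    rcases Nat.eq_zero_or_pos Δ with rfl | h'
    · simp at h
    · exact h'
  have hb : 0 < qDot (fun _ : Fin Δ => (1 : ℝ)) := by
    refine Finset.sum_pos (fun d _ => by positivity) ⟨⟨0, hΔ⟩, Finset.mem_univ _⟩
  -- The constant vector `b` has duration `1 / 2` in each state, so it is a type.
  set b := 1 / (2 * qDot (fun _ : Fin Δ => (1 : ℝ))) with hbdef
  have hb0 : 0 < b := by positivity
  set γ : ℝ → Fin 2 → Fin Δ → ℝ := fun η m d => (1 - η) * ν m d + η * b with hγ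
  have hγc : Continuous γ := by fun_prop
  have hγ0 : γ 0 = ν := by ext m d; simp [hγ]
  have hqγ : ∀ η m, qDot (γ η m) =
      (1 - η) * qDot (ν m) + η * b * qDot (fun _ : Fin Δ => (1 : ℝ)) := fun η m => by
    simp only [qDot, hγ, Finset.mul_sum, ← Finset.sum_add_distrib]
    exact Finset.sum_congr rfl fun d _ => by ring
  have hγt : ∀ η ∈ Set.Ioo (0 : ℝ) 1, γ η ∈ typeSet Δ ∧ ∀ m d, 0 < γ η m d := by
    intro η hη
    have hp : ∀ m d, 0 < γ η m d := fun m d =>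
      add_pos_of_nonneg_of_pos (mul_nonneg (by linarith [hη.2]) (hν.1 m d)) (mul_pos hη.1 hb0)
    refine ⟨⟨fun m d => (hp m d).le, ?_, ?_⟩, hp⟩
    · simp only [hγ, Finset.sum_add_distrib, ← Finset.mul_sum, hν.2.1]
    · rw [hqγ, hqγ]
      have h1 : b * qDot (fun _ : Fin Δ => (1 : ℝ)) = 1 / 2 := by
        rw [hbdef]; field_simp
      have h2 := hν.2.2
      linear_combination (1 - η) * h2 + 2 * η * h1
  have ht : Tendsto γ (𝓝[>] 0) (𝓝[typeSet Δ] ν) := by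
    refine tendsto_nhdsWithin_iff.2 ⟨?_, ?_⟩
    · rw [← hγ0]; exact hγc.continuousAt.mono_left nhdsWithin_le_nhds
    · filter_upwards [Ioo_mem_nhdsGT (zero_lt_one' ℝ)] with η hη using (hγt η hη).1
  have hH : ∀ᶠ η in 𝓝[>] (0 : ℝ), totalEntropy ν - ε < totalEntropy (γ η) :=
    ht.eventually ((continuousOn_totalEntropy Δ ν hν).eventually_const_lt (by linarith))
  have hUe : ∀ᶠ η in 𝓝[>] (0 : ℝ), U ∈ 𝓝 (γ η) :=
    ht.eventually (nhdsWithin_le_nhds (eventually_mem_nhds_iff.2 hU))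
  obtain ⟨η, h1, h2, h3⟩ := (hH.and (hUe.and (Ioo_mem_nhdsGT (zero_lt_one' ℝ)))).exists
  exact ⟨γ η, (hγt η h3).1, (hγt η h3).2, h2, h1⟩

/-- Lower bound on the number of sequences with type near a given one. -/
theorem eventually_le_card_typeClass {Δ : ℕ} (p : Fin 2 → Fin Δ → ℝ)
    (hp : ∀ m d, 0 < p m d) {ν : Fin 2 → Fin Δ → ℝ} (hν : ν ∈ typeSet Δ)
    {U : Set (Fin 2 → Fin Δ → ℝ)} (hU : U ∈ 𝓝 ν) {ε : ℝ} (hε : 0 < ε) :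
    ∀ᶠ t : ℕ in atTop, Real.exp (t * (totalEntropy ν - ε)) ≤ (typeClass p t U).card := by
  obtain ⟨ν', h1, h2, h3, h4⟩ := exists_pos_mem_typeSet_near hν hU (half_pos hε)
  filter_upwards [eventually_le_card_typeClass_of_pos p hp h1 h2 h3 (half_pos hε)] with t ht
  refine le_trans (Real.exp_le_exp.2 (mul_le_mul_of_nonneg_left ?_ (Nat.cast_nonneg t))) ht
  linarith

/-! ### The root `ψ` and the growth rate of the number of sequences -/

/-- The maximal-entropy duration weights `ψ⁻¹, …, ψ^(-Δ)`. -/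
def rootWeight (Δ : ℕ) (ψ : ℝ) : Fin 2 → Fin Δ → ℝ := fun _ d => (ψ ^ ((d : ℕ) + 1))⁻¹

theorem sum_rootWeight {Δ : ℕ} {ψ : ℝ} (hψ : 0 < ψ)
    (hroot : ψ ^ Δ = ∑ i ∈ Finset.range Δ, ψ ^ i) (m : Fin 2) : ∑ d, rootWeight Δ ψ m d = 1 := by
  have h : (∑ d, rootWeight Δ ψ m d) * ψ ^ Δ = ψ ^ Δ := by
    simp only [rootWeight]
    rw [Fin.sum_univ_eq_sum_range (fun d => (ψ ^ (d + 1))⁻¹), Finset.sum_mul]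
    conv_rhs => rw [hroot]
    rw [← Finset.sum_range_reflect (fun i => ψ ^ i)]
    refine Finset.sum_congr rfl fun d hd => ?_
    have hd' := Finset.mem_range.1 hd
    rw [← div_eq_inv_mul, div_eq_iff (pow_pos hψ _).ne', ← pow_add]
    congr 1
    omega
  exact mul_right_cancel₀ (pow_pos hψ Δ).ne' (h.trans (one_mul _).symm)

/-- At total duration `1` this is the constant `-log ψ`, so all feasible sequences of length `t`
have the same weight `ψ ^ (-t)`. -/
theorem logWeight_rootWeight {Δ : ℕ} {ψ : ℝ} (ν : Fin 2 → Fin Δ → ℝ) :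
    logWeight (rootWeight Δ ψ) ν = -((qDot (ν 0) + qDot (ν 1)) * Real.log ψ) := by
  have : ∀ m, ∑ d, ν m d * Real.log (rootWeight Δ ψ m d) = -(qDot (ν m) * Real.log ψ) := fun m => by
    rw [qDot, Finset.sum_mul, ← Finset.sum_neg_distrib]
    refine Finset.sum_congr rfl fun d _ => ?_
    rw [rootWeight, Real.log_inv, Real.log_pow]
    push_cast
    ring
  rw [logWeight, Fin.sum_univ_two, this, this]
  ring

theorem totalEntropy_le_log {Δ : ℕ} {ψ : ℝ} (hψ : 0 < ψ)
    (hroot : ψ ^ Δ = ∑ i ∈ Finset.range Δ, ψ ^ i) {ν : Fin 2 → Fin Δ → ℝ} (hν : ν ∈ typeSet Δ) :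
    totalEntropy ν ≤ Real.log ψ := by
  have h := totalEntropy_add_logWeight_nonpos hν
    (π := rootWeight Δ ψ) (fun m d => inv_pos.2 (pow_pos hψ _)) (sum_rootWeight hψ hroot)
  rw [logWeight_rootWeight, hν.2.2] at h
  linarith

theorem card_feasible_bounds {Δ : ℕ} (p : Fin 2 → Fin Δ → ℝ) (hp : ∀ m d, 0 < p m d) {ψ : ℝ}
    (hψ : 0 < ψ) (hroot : ψ ^ Δ = ∑ i ∈ Finset.range Δ, ψ ^ i) :
    ∃ κ : ℝ, 0 < κ ∧ ∀ t : ℕ, 1 ≤ t → κ * Real.exp (t * Real.log ψ) ≤ (feasible p t).card ∧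
      ((feasible p t).card : ℝ) ≤ Real.exp (t * Real.log ψ) := by
  have hpos : ∀ m d, 0 < rootWeight Δ ψ m d := fun m d => inv_pos.2 (pow_pos hψ _)
  obtain ⟨κ, hκ, h1⟩ := exists_le_sum_feasible_seqWeight p hp _ hpos (sum_rootWeight hψ hroot)
  have hw : ∀ t, 1 ≤ t → ∑ s ∈ feasible p t, seqWeight (rootWeight Δ ψ) s =
      (feasible p t).card / Real.exp (t * Real.log ψ) := fun t ht => by
    rw [Finset.sum_congr rfl (g := fun _ => (Real.exp (t * Real.log ψ))⁻¹)]
    · simp [div_eq_mul_inv]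
    · intro s hs
      rw [seqWeight_eq_exp ht _ hpos, logWeight_rootWeight, qDot_seqType_add ht p hs,
        ← Real.exp_neg]
      congr 1; ring
  refine ⟨κ, hκ, fun t ht => ⟨?_, ?_⟩⟩
  · have h := h1 t
    rwa [hw t ht, le_div_iff₀ (Real.exp_pos _)] at h
  · have h := sum_feasible_seqWeight_le_one p hp _ (fun m d => (hpos m d).le)
      (sum_rootWeight hψ hroot) t
    rwa [hw t ht, div_le_one (Real.exp_pos _)] at h

/-! ### Borel–Cantelli and Gaussian estimates -/

theorem ae_eventually_notMem_of_exp_bound {Ω : Type*} [MeasurableSpace Ω] (P : Measure Ω)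
    [IsFiniteMeasure P] (A : ℕ → Set Ω) (C : ℝ) {c : ℝ} (hc : 0 < c)
    (h : ∀ᶠ t : ℕ in atTop, P.real (A t) ≤ C * Real.exp (-(t * c))) :
    ∀ᵐ ω ∂P, ∀ᶠ t in atTop, ω ∉ A t := by
  have h1 : Summable fun t : ℕ => C * Real.exp (-(t * c)) := by
    simp_rw [← mul_neg]
    exact (Real.summable_exp_nat_mul_iff.2 (by linarith)).mul_left C
  have h2 : Summable fun t => P.real (A t) :=
    Summable.of_norm_bounded_eventually_nat h1 (h.mono fun t ht => by
      rwa [Real.norm_of_nonneg measureReal_nonneg])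
  apply ae_eventually_notMem
  convert h2.tsum_ofReal_ne_top using 3 with t
  exact (ofReal_measureReal (measure_ne_top P _)).symm

/-- Allowing any `c ≥ v` gives tail bounds uniform over sequences, and covers `v = 0`, the case of a
sequence that never visits state 2. -/
theorem hasSubgaussianMGF_of_hasLaw {Ω : Type*} [MeasurableSpace Ω] {P : Measure Ω}
    {X : Ω → ℝ} {v c : NNReal} (hX : HasLaw X (gaussianReal 0 v) P) (hv : v ≤ c) :
    HasSubgaussianMGF X c P where
  integrable_exp_mul t := by
    have h := integrable_exp_mul_gaussianReal (μ := 0) (v := v) t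
    rw [← hX.map_eq, integrable_map_measure (by fun_prop) hX.aemeasurable] at h
    exact h
  mgf_le t := by
    rw [mgf_gaussianReal hX.map_eq, Real.exp_le_exp, zero_mul, zero_add]
    gcongr

theorem measureReal_le_abs_le_of_hasLaw {Ω : Type*} [MeasurableSpace Ω] {P : Measure Ω}
    [IsProbabilityMeasure P] {X : Ω → ℝ} {v : NNReal} (hX : HasLaw X (gaussianReal 0 v) P)
    {c : ℝ} (hc : 0 ≤ c) (hv : (v : ℝ) ≤ c) {r : ℝ} (hr : 0 ≤ r) :
    P.real {ω | r ≤ |X ω|} ≤ 2 * Real.exp (-(r ^ 2 / (2 * c))) := by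
  lift c to NNReal using hc
  have h := hasSubgaussianMGF_of_hasLaw hX (NNReal.coe_le_coe.1 hv)
  have h1 := h.measure_ge_le hr
  have h2 := h.neg.measure_ge_le hr
  have h3 : {ω | r ≤ |X ω|} = {ω | r ≤ X ω} ∪ {ω | r ≤ (-X) ω} := by
    ext ω; simp [le_abs]
  rw [h3]
  refine (measureReal_union_le _ _).trans ?_
  rw [neg_div] at h1 h2
  linarith

/-- The assumption `2πv ≤ 1` makes the prefactor of the density at least `1`. The exponential is
smallest where `|x|` is largest, and `|x| ≤ |ξ| + δ` on the interval. -/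
theorem le_measureReal_abs_sub_lt_of_hasLaw {Ω : Type*} [MeasurableSpace Ω] {P : Measure Ω}
    [IsProbabilityMeasure P] {X : Ω → ℝ} {v : NNReal} (hX : HasLaw X (gaussianReal 0 v) P)
    (hv : 0 < v) (hv1 : 2 * Real.pi * v ≤ 1) (ξ : ℝ) {δ : ℝ} (hδ : 0 < δ) :
    δ * Real.exp (-((|ξ| + δ) ^ 2 / (2 * v))) ≤ P.real {ω | |X ω - ξ| < δ} := by
  set b := Real.exp (-((|ξ| + δ) ^ 2 / (2 * v))) with hb
  have hv0 : (0 : ℝ) < v := hv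
  have hS : {x : ℝ | |x - ξ| < δ} = Set.Ioo (ξ - δ) (ξ + δ) := by
    ext x; simp only [Set.mem_ofPred_eq, Set.mem_Ioo, abs_lt]
    constructor <;> rintro ⟨h1, h2⟩ <;> constructor <;> linarith
  rw [hX.measureReal_eq (p := fun x => |x - ξ| < δ) (by rw [hS]; exact measurableSet_Ioo), hS,
    measureReal_def, ← ENNReal.ofReal_le_iff_le_toReal (measure_ne_top _ _),
    gaussianReal_apply 0 hv.ne']
  calc ENNReal.ofReal (δ * b) ≤ ENNReal.ofReal b * volume (Set.Ioo (ξ - δ) (ξ + δ)) := by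
        rw [Real.volume_Ioo, ← ENNReal.ofReal_mul (Real.exp_pos _).le]
        apply ENNReal.ofReal_le_ofReal
        have : 0 < b := Real.exp_pos _
        nlinarith
    _ = ∫⁻ _ in Set.Ioo (ξ - δ) (ξ + δ), ENNReal.ofReal b := (setLIntegral_const _ _).symm
    _ ≤ _ := by
        refine setLIntegral_mono (measurable_gaussianPDF 0 v) fun x hx => ?_
        apply ENNReal.ofReal_le_ofReal
        rw [gaussianPDFReal_def]
        have hs : 1 ≤ (√(2 * Real.pi * v))⁻¹ := by
          refine one_le_inv_iff₀.2 ⟨Real.sqrt_pos.2 (by positivity), ?_⟩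
          rwa [Real.sqrt_le_one]
        refine le_trans ?_ (le_mul_of_one_le_left (Real.exp_pos _).le hs)
        rw [hb, Real.exp_le_exp, sub_zero, neg_div, neg_le_neg_iff]
        have hx' : |x| ≤ |ξ| + δ := by
          have h1 : |x - ξ| ≤ δ := abs_le.2 ⟨by linarith [hx.1], by linarith [hx.2]⟩
          have h2 := abs_add_le ξ (x - ξ)
          rw [add_sub_cancel] at h2
          linarith
        rw [← sq_abs x]
        gcongr

/-! ### First and second moments of hit counts -/

/-- The number of `s ∈ G` with `z s ∈ U`. -/
def hitCount {ι : Type*} (G : Finset ι) (U : Set ℝ) (z : ι → ℝ) : ℝ :=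
  ∑ s ∈ G, U.indicator (fun _ => (1 : ℝ)) (z s)

theorem indicator_one_nonneg (U : Set ℝ) (x : ℝ) : 0 ≤ U.indicator (fun _ => (1 : ℝ)) x :=
  Set.indicator_nonneg (fun _ _ => zero_le_one) x

theorem hitCount_nonneg {ι : Type*} (G : Finset ι) (U : Set ℝ) (z : ι → ℝ) : 0 ≤ hitCount G U z :=
  Finset.sum_nonneg fun _ _ => indicator_one_nonneg U _

theorem notMem_of_hitCount_lt_one {ι : Type*} {G : Finset ι} {U : Set ℝ} {z : ι → ℝ}
    (h : hitCount G U z < 1) : ∀ s ∈ G, z s ∉ U := by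
  intro s hs hz
  have h1 := Finset.single_le_sum (f := fun s => U.indicator (fun _ => (1 : ℝ)) (z s))
    (fun s _ => indicator_one_nonneg U _) hs
  simp only [Set.indicator_of_mem hz] at h1
  exact absurd (h1.trans_lt h) (lt_irrefl _)

theorem hitCount_eq_zero_of_lt_one {ι : Type*} {G : Finset ι} {U : Set ℝ} {z : ι → ℝ}
    (h : hitCount G U z < 1) : hitCount G U z = 0 :=
  Finset.sum_eq_zero fun s hs => Set.indicator_of_notMem (notMem_of_hitCount_lt_one h s hs) _

theorem integral_indicator_one_comp {Ω : Type*} [MeasurableSpace Ω] {P : Measure Ω}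
    {X : Ω → ℝ} (hX : AEMeasurable X P) {U : Set ℝ} (hU : MeasurableSet U) :
    ∫ ω, U.indicator (fun _ => (1 : ℝ)) (X ω) ∂P = P.real {ω | X ω ∈ U} := by
  have : (fun ω => U.indicator (fun _ => (1 : ℝ)) (X ω)) =
      (X ⁻¹' U).indicator fun _ => (1 : ℝ) := rfl
  rw [this, integral_indicator₀ (hX.nullMeasurableSet_preimage hU)]
  simp
  rfl

theorem memLp_indicator_one_comp {Ω : Type*} [MeasurableSpace Ω] {P : Measure Ω}
    [IsFiniteMeasure P] {X : Ω → ℝ} (hX : AEMeasurable X P) {U : Set ℝ} (hU : MeasurableSet U)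
    (q : ENNReal) : MemLp (fun ω => U.indicator (fun _ => (1 : ℝ)) (X ω)) q P := by
  refine MemLp.of_bound ?_ 1 (ae_of_all _ fun ω => ?_)
  · exact ((measurable_const.indicator hU).comp_aemeasurable hX).aestronglyMeasurable
  · rw [Real.norm_of_nonneg (indicator_one_nonneg U _)]
    exact Set.indicator_le_self' (fun _ _ => zero_le_one) _

/-- Markov's inequality; independence plays no role in the upper bound. -/
theorem mul_measureReal_le_hitCount_le {Ω ι : Type*} [MeasurableSpace Ω] (P : Measure Ω)
    [IsFiniteMeasure P] (G : Finset ι) (Y : ι → Ω → ℝ) (hY : ∀ s ∈ G, AEMeasurable (Y s) P)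
    {U : Set ℝ} (hU : MeasurableSet U) {b : ℝ} (hb : ∀ s ∈ G, P.real {ω | Y s ω ∈ U} ≤ b) (a : ℝ) :
    a * P.real {ω | a ≤ hitCount G U fun s => Y s ω} ≤ G.card * b := by
  have hint : ∀ s ∈ G, Integrable (fun ω => U.indicator (fun _ => (1 : ℝ)) (Y s ω)) P :=
    fun s hs => (memLp_indicator_one_comp (hY s hs) hU 1).integrable le_rfl
  refine (mul_meas_ge_le_integral_of_nonneg (ae_of_all _ fun ω => hitCount_nonneg G U _)
    (integrable_finsetSum _ hint) a).trans ?_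
  unfold hitCount
  rw [integral_finsetSum _ hint, ← nsmul_eq_mul]
  refine Finset.sum_le_card_nsmul _ _ _ fun s hs => ?_
  rw [integral_indicator_one_comp (hY s hs) hU]
  exact hb s hs

/-- Chebyshev's inequality: by pairwise independence the variance is a sum of variances of
indicators, each at most its mean, so the total variance is at most the mean. -/
theorem measureReal_hitCount_lt_le {Ω ι : Type*} [MeasurableSpace Ω] (P : Measure Ω)
    [IsProbabilityMeasure P] (G : Finset ι) (Y : ι → Ω → ℝ) (hY : ∀ s ∈ G, AEMeasurable (Y s) P)
    (hind : (G : Set ι).Pairwise fun s s' => IndepFun (Y s) (Y s') P)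
    {U : Set ℝ} (hU : MeasurableSet U) {b : ℝ} (hb : ∀ s ∈ G, b ≤ P.real {ω | Y s ω ∈ U})
    (hpos : 0 < G.card * b) :
    P.real {ω | hitCount G U (fun s => Y s ω) < G.card * b / 2} ≤ 4 / (G.card * b) := by
  set X : ι → Ω → ℝ := fun s ω => U.indicator (fun _ => (1 : ℝ)) (Y s ω) with hXdef
  have hL : ∀ s ∈ G, MemLp (X s) 2 P := fun s hs => memLp_indicator_one_comp (hY s hs) hU 2
  have hint : ∀ s ∈ G, Integrable (X s) P := fun s hs => (hL s hs).integrable (by norm_num)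
  set μ := ∫ ω, (∑ s ∈ G, X s) ω ∂P with hμ
  have hμeq : μ = ∑ s ∈ G, P.real {ω | Y s ω ∈ U} := by
    rw [hμ]
    simp only [Finset.sum_apply]
    rw [integral_finsetSum _ hint]
    exact Finset.sum_congr rfl fun s hs => integral_indicator_one_comp (hY s hs) hU
  have hμb : G.card * b ≤ μ := by
    rw [hμeq, ← nsmul_eq_mul]
    exact Finset.card_nsmul_le_sum _ _ _ hb
  have hμ0 : 0 < μ := hpos.trans_le hμb
  have hvar : Var[∑ s ∈ G, X s; P] ≤ μ := by
    rw [IndepFun.variance_sum hL fun s hs s' hs' hne =>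
      (hind hs hs' hne).comp (measurable_const.indicator hU) (measurable_const.indicator hU), hμeq]
    refine Finset.sum_le_sum fun s hs => ?_
    refine (variance_le_expectation_sq (hL s hs).1).trans ?_
    rw [← integral_indicator_one_comp (hY s hs) hU]
    refine le_of_eq (integral_congr_ae (ae_of_all _ fun ω => ?_))
    simp only [hXdef, Pi.pow_apply]
    by_cases h : Y s ω ∈ U <;> simp [h]
  have hcheb := meas_ge_le_variance_div_sq (memLp_finsetSum' G hL) (half_pos hμ0)
  rw [← hμ] at hcheb
  have h1 : P.real {ω | μ / 2 ≤ |(∑ s ∈ G, X s) ω - μ|} ≤ Var[∑ s ∈ G, X s; P] / (μ / 2) ^ 2 :=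
    ENNReal.toReal_le_of_le_ofReal (div_nonneg (variance_nonneg _ _) (sq_nonneg _)) hcheb
  have h2 : {ω | hitCount G U (fun s => Y s ω) < G.card * b / 2} ⊆
      {ω | μ / 2 ≤ |(∑ s ∈ G, X s) ω - μ|} := by
    intro ω hω
    have h3 : (∑ s ∈ G, X s) ω < G.card * b / 2 := by
      rw [Finset.sum_apply]; exact hω
    have h4 := neg_abs_le ((∑ s ∈ G, X s) ω - μ)
    simp only [Set.mem_ofPred_eq]
    linarith
  refine (measureReal_mono h2).trans (h1.trans ?_)
  calc Var[∑ s ∈ G, X s; P] / (μ / 2) ^ 2 ≤ μ / (μ / 2) ^ 2 := by gcongr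
    _ = 4 / μ := by field_simp; norm_num
    _ ≤ 4 / (G.card * b) := by gcongr

/-! ### Exponential bounds on the logarithmic scale -/

theorem tendsto_ereal_log_div (M a : ℝ) :
    Tendsto (fun t : ℕ => (((Real.log M - t * a) / t : ℝ) : EReal)) atTop (𝓝 ((-a : ℝ) : EReal)) := by
  rw [EReal.tendsto_coe]
  have h : Tendsto (fun t : ℕ => Real.log M / t - a) atTop (𝓝 (0 - a)) :=
    (tendsto_const_div_atTop_nhds_zero_nat _).sub_const a
  rw [zero_sub] at h
  refine h.congr' ?_
  filter_upwards [eventually_ge_atTop 1] with t ht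
  have : (t : ℝ) ≠ 0 := by positivity
  field_simp

theorem log_ofReal_mul_exp_div {M : ℝ} (hM : 0 < M) (a : ℝ) (t : ℕ) :
    ENNReal.log (ENNReal.ofReal (M * Real.exp (-(t * a)))) / (t : EReal) =
      (((Real.log M - t * a) / t : ℝ) : EReal) := by
  rw [ENNReal.log_ofReal_of_pos (by positivity), Real.log_mul hM.ne' (Real.exp_pos _).ne',
    Real.log_exp, ← sub_eq_add_neg, EReal.coe_div]
  rfl

theorem limsup_log_div_le {q : ℕ → ENNReal} {M a : ℝ}
    (h : ∀ᶠ t : ℕ in atTop, q t ≤ ENNReal.ofReal (M * Real.exp (-(t * a)))) :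
    limsup (fun t : ℕ => ENNReal.log (q t) / (t : EReal)) atTop ≤ ((-a : ℝ) : EReal) := by
  -- `M` may be zero or negative here; enlarging it to `max M 1` keeps the logarithm of the bound
  -- finite and does not affect the limit.
  rw [← (tendsto_ereal_log_div (max M 1) a).limsup_eq]
  refine limsup_le_limsup (h.mono fun t ht => ?_)
  beta_reduce
  rw [← log_ofReal_mul_exp_div (by positivity) a t]
  refine EReal.div_le_div_right_of_nonneg (by positivity) (ENNReal.log_le_log (ht.trans ?_))
  apply ENNReal.ofReal_le_ofReal
  gcongr
  exact le_max_left _ _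

theorem le_liminf_log_div {q : ℕ → ENNReal} {M a : ℝ} (hM : 0 < M)
    (h : ∀ᶠ t : ℕ in atTop, ENNReal.ofReal (M * Real.exp (-(t * a))) ≤ q t) :
    ((-a : ℝ) : EReal) ≤ liminf (fun t : ℕ => ENNReal.log (q t) / (t : EReal)) atTop := by
  rw [← (tendsto_ereal_log_div M a).liminf_eq]
  refine liminf_le_liminf (h.mono fun t ht => ?_)
  rw [← log_ofReal_mul_exp_div hM a t]
  exact EReal.div_le_div_right_of_nonneg (by positivity) (ENNReal.log_le_log ht)

/-! ### Hit counts of the Gaussian field -/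

/-- Independent centred Gaussian variables with variances `σ² Θ₂(s) / t`, indexed by the feasible
sequences. -/
structure GaussianField {Δ : ℕ} (p : Fin 2 → Fin Δ → ℝ) (σ : ℝ) {Ω : Type*} [MeasurableSpace Ω]
    (P : Measure Ω) (Z : (t : ℕ) → (Fin t → Fin 2) → Ω → ℝ) : Prop where
  pos : ∀ m d, 0 < p m d
  sigma_pos : 0 < σ
  indep : ∀ t, 1 ≤ t → iIndepFun (fun s : {s // s ∈ feasible p t} => Z t s.1) P
  law : ∀ t, 1 ≤ t → ∀ s ∈ feasible p t,
    HasLaw (Z t s) (gaussianReal 0 (σ ^ 2 * fracState2 s / t).toNNReal) P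

theorem fracState2_le_one {t : ℕ} (s : Fin t → Fin 2) : fracState2 s ≤ 1 := by
  refine div_le_one_of_le₀ ?_ (Nat.cast_nonneg t)
  exact_mod_cast (Finset.card_filter_le _ _).trans (by simp)

theorem fracState2_nonneg {t : ℕ} (s : Fin t → Fin 2) : 0 ≤ fracState2 s := by
  unfold fracState2; positivity

theorem empMeasure_prod {Δ : ℕ} (p : Fin 2 → Fin Δ → ℝ) (t : ℕ) (z : (Fin t → Fin 2) → ℝ)
    (hne : 0 < ((feasible p t).card : ℝ)) (U : Set (Fin 2 → Fin Δ → ℝ)) (W : Set ℝ) :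
    empMeasure p t z (U ×ˢ W) =
      ENNReal.ofReal (hitCount (typeClass p t U) W z / (feasible p t).card) := by
  classical
  rw [empMeasure, Measure.smul_apply, Measure.finsetSum_apply, smul_eq_mul, div_eq_inv_mul,
    ENNReal.ofReal_mul (inv_nonneg.2 hne.le), ENNReal.ofReal_inv_of_pos hne, ENNReal.ofReal_natCast]
  congr 1
  rw [hitCount, typeClass, Finset.sum_filter,
    ENNReal.ofReal_sum_of_nonneg (fun s _ => by
      split_ifs
      · exact indicator_one_nonneg W _
      · rfl)]
  refine Finset.sum_congr rfl fun s _ => ?_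
  rw [Measure.dirac_apply]
  by_cases h1 : seqType Δ s ∈ U <;> by_cases h2 : z s ∈ W <;> simp [h1, h2]

namespace GaussianField

theorem aemeasurable {Δ : ℕ} {p : Fin 2 → Fin Δ → ℝ} {σ : ℝ} {Ω : Type*} [MeasurableSpace Ω]
    {P : Measure Ω} {Z : (t : ℕ) → (Fin t → Fin 2) → Ω → ℝ} (hG : GaussianField p σ P Z) {t : ℕ}
    (ht : 1 ≤ t) {s : Fin t → Fin 2} (hs : s ∈ feasible p t) : AEMeasurable (Z t s) P :=
  (hG.law t ht s hs).aemeasurable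

variable {Δ : ℕ} {p : Fin 2 → Fin Δ → ℝ} {σ : ℝ} {Ω : Type*} [MeasurableSpace Ω]
  {P : Measure Ω} [IsProbabilityMeasure P] {Z : (t : ℕ) → (Fin t → Fin 2) → Ω → ℝ}

theorem measureReal_le_abs_le (hG : GaussianField p σ P Z) {t : ℕ} (ht : 1 ≤ t)
    {s : Fin t → Fin 2} (hs : s ∈ feasible p t) {θ : ℝ} (hθ : fracState2 s ≤ θ) {r : ℝ}
    (hr : 0 ≤ r) :
    P.real {ω | r ≤ |Z t s ω|} ≤ 2 * Real.exp (-(t * (r ^ 2 / (2 * σ ^ 2 * θ)))) := by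
  have ht0 : (0 : ℝ) < t := by exact_mod_cast ht
  have h0 := fracState2_nonneg s
  have hσ := hG.sigma_pos
  refine (measureReal_le_abs_le_of_hasLaw (hG.law t ht s hs) (c := σ ^ 2 * θ / t)
    (by have := h0.trans hθ; positivity) ?_ hr).trans (le_of_eq ?_)
  · rw [Real.coe_toNNReal _ (by positivity)]
    gcongr
  · congr 3
    rw [← mul_div_assoc, ← mul_div_assoc, div_div_eq_mul_div, ← mul_assoc, mul_comm (r ^ 2)]

/-- Tail bound for the hit counts: if the mean decays relative to the threshold, then almost surely
the hit counts are eventually below the threshold. -/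
theorem ae_eventually_hitCount_lt (hG : GaussianField p σ P Z) (U : Set (Fin 2 → Fin Δ → ℝ))
    {W : Set ℝ} (hW : MeasurableSet W) {h j c a : ℝ} (hc : 0 < c) (ha : h - j + c ≤ a)
    (hcard : ∀ᶠ t : ℕ in atTop, ((typeClass p t U).card : ℝ) ≤ Real.exp (t * h))
    (hprob : ∀ᶠ t : ℕ in atTop, ∀ s ∈ typeClass p t U,
      P.real {ω | Z t s ω ∈ W} ≤ 2 * Real.exp (-(t * j))) :
    ∀ᵐ ω ∂P, ∀ᶠ t : ℕ in atTop,
      hitCount (typeClass p t U) W (fun s => Z t s ω) < Real.exp (t * a) := by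
  have := ae_eventually_notMem_of_exp_bound P (fun t : ℕ => {ω | Real.exp (t * a) ≤
    hitCount (typeClass p t U) W (fun s => Z t s ω)}) 2 hc ?_
  · filter_upwards [this] with ω hω
    exact hω.mono fun t ht => not_le.1 ht
  · filter_upwards [hcard, hprob, eventually_ge_atTop 1] with t h1 h2 ht
    have h3 := mul_measureReal_le_hitCount_le P (typeClass p t U) (fun s => Z t s)
      (fun s hs => hG.aemeasurable ht (mem_typeClass.1 hs).1) hW h2 (Real.exp (t * a))
    have h4 : ((typeClass p t U).card : ℝ) * (2 * Real.exp (-(t * j))) ≤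
        Real.exp (t * a) * (2 * Real.exp (-(t * c))) := by
      calc ((typeClass p t U).card : ℝ) * (2 * Real.exp (-(t * j)))
          ≤ Real.exp (t * h) * (2 * Real.exp (-(t * j))) := by gcongr
        _ = 2 * Real.exp (t * (h - j)) := by
            rw [mul_left_comm, ← Real.exp_add]; congr 2; ring
        _ ≤ 2 * Real.exp (t * (a - c)) := by
            exact mul_le_mul_of_nonneg_left (Real.exp_le_exp.2 (mul_le_mul_of_nonneg_left
              (by linarith) (Nat.cast_nonneg t))) zero_le_two
        _ = _ := by rw [mul_left_comm, ← Real.exp_add]; congr 2; ring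
    exact le_of_mul_le_mul_left (h3.trans h4) (Real.exp_pos _)

/-- `W` is the two-sided tail `|z| ≥ (1 - η)|ξ|`, a neighbourhood of `ξ` (the whole line if `ξ =
0`), and `U` lets the time in state 2 grow by a factor at most `1 + η`. Continuity in `η` keeps the
loss in the exponent below `ε`. -/
theorem exists_nhds_tail (hG : GaussianField p σ P Z) {ν : Fin 2 → Fin Δ → ℝ}
    (hν : ν ∈ typeSet Δ) (ξ : ℝ) {ε : ℝ} (hε : 0 < ε) :
    ∃ U ∈ 𝓝 ν, ∃ W ∈ 𝓝 ξ, MeasurableSet W ∧ ∀ᶠ t : ℕ in atTop, ∀ s ∈ typeClass p t U,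
      P.real {ω | Z t s ω ∈ W} ≤ 2 * Real.exp (-(t * (gaussRate σ ν ξ - ε))) := by
  have hθ := qDot_pos_of_mem_typeSet hν 1
  have hσ := hG.sigma_pos
  have hlim : Tendsto (fun η : ℝ => ((1 - η) * |ξ|) ^ 2 / (2 * σ ^ 2 * ((1 + η) * qDot (ν 1))))
      (𝓝[>] 0) (𝓝 (gaussRate σ ν ξ)) := by
    have : ContinuousAt (fun η : ℝ =>
        ((1 - η) * |ξ|) ^ 2 / (2 * σ ^ 2 * ((1 + η) * qDot (ν 1)))) 0 := by
      refine ContinuousAt.div (by fun_prop) (by fun_prop) ?_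
      simp only [add_zero, one_mul]; positivity
    have h := this.tendsto.mono_left (nhdsWithin_le_nhds (s := Set.Ioi 0))
    simpa [gaussRate] using h
  obtain ⟨η, h1, h2⟩ := ((hlim.eventually_const_lt (sub_lt_self _ hε)).and
    (Ioo_mem_nhdsGT (zero_lt_one' ℝ))).exists
  refine ⟨{V | qDot (V 1) < (1 + η) * qDot (ν 1)},
    (isOpen_lt (continuous_qDot.comp (continuous_apply 1)) continuous_const).mem_nhds
      (show qDot (ν 1) < (1 + η) * qDot (ν 1) by nlinarith [h2.1]),
    {z | (1 - η) * |ξ| ≤ |z|}, ?_, (isClosed_le continuous_const continuous_abs).measurableSet, ?_⟩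
  · by_cases hξ : ξ = 0
    · subst hξ
      refine univ_mem' fun z => ?_
      simp
    · have : 0 < |ξ| := abs_pos.2 hξ
      have h3 : {z | (1 - η) * |ξ| < |z|} ∈ 𝓝 ξ :=
        (isOpen_lt continuous_const continuous_abs).mem_nhds
          (by simp only [Set.mem_ofPred_eq]; nlinarith [h2.1])
      exact mem_of_superset h3 fun z hz =>
        show (1 - η) * |ξ| ≤ |z| from le_of_lt hz
  · filter_upwards [eventually_ge_atTop 1] with t ht s hs
    have hs' := mem_typeClass.1 hs
    refine (hG.measureReal_le_abs_le ht hs'.1 (θ := (1 + η) * qDot (ν 1)) ?_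
      (mul_nonneg (by linarith [h2.2]) (abs_nonneg ξ))).trans ?_
    · rw [fracState2_eq_qDot p hs'.1]
      exact le_of_lt hs'.2
    · gcongr

theorem exists_nhds_lower (hG : GaussianField p σ P Z) {ν : Fin 2 → Fin Δ → ℝ}
    (hν : ν ∈ typeSet Δ) {ξ : ℝ} {W : Set ℝ} (hW : W ∈ 𝓝 ξ) {ε : ℝ} (hε : 0 < ε) :
    ∃ U ∈ 𝓝 ν, ∀ᶠ t : ℕ in atTop, ∀ s ∈ typeClass p t U,
      Real.exp (-(t * (gaussRate σ ν ξ + ε))) ≤ P.real {ω | Z t s ω ∈ W} := by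
  have hθ := qDot_pos_of_mem_typeSet hν 1
  have hσ := hG.sigma_pos
  obtain ⟨δ, hδ, hball⟩ := Metric.mem_nhds_iff.1 hW
  have hlim : Tendsto (fun η : ℝ => (|ξ| + η) ^ 2 / (2 * σ ^ 2 * ((1 - η) * qDot (ν 1))))
      (𝓝[>] 0) (𝓝 (gaussRate σ ν ξ)) := by
    have : ContinuousAt (fun η : ℝ =>
        (|ξ| + η) ^ 2 / (2 * σ ^ 2 * ((1 - η) * qDot (ν 1)))) 0 := by
      refine ContinuousAt.div (by fun_prop) (by fun_prop) ?_
      simp only [sub_zero, one_mul]; positivity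
    have h := this.tendsto.mono_left (nhdsWithin_le_nhds (s := Set.Ioi 0))
    simpa [gaussRate] using h
  obtain ⟨η, h1, h2, h3⟩ := ((hlim.eventually_lt_const (lt_add_of_pos_right _ (half_pos hε))).and
    (inter_mem (Ioo_mem_nhdsGT (zero_lt_one' ℝ)) (Ioo_mem_nhdsGT hδ))).exists
  have hθ1 : 0 < (1 - η) * qDot (ν 1) := mul_pos (by linarith [h2.2]) hθ
  refine ⟨{V | (1 - η) * qDot (ν 1) < qDot (V 1)},
    (isOpen_lt continuous_const (continuous_qDot.comp (continuous_apply 1))).mem_nhds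
      (show (1 - η) * qDot (ν 1) < qDot (ν 1) by nlinarith [h2.1]), ?_⟩
  -- The first bound on `t` absorbs the interval length `η` into `exp (-t ε / 2)`; the second
  -- ensures `2πv ≤ 1` for every variance `v` that occurs.
  filter_upwards [eventually_ge_atTop 1, eventually_le_exp_mul η⁻¹ (half_pos hε),
    tendsto_natCast_atTop_atTop.eventually_ge_atTop (2 * Real.pi * σ ^ 2)] with t ht hηt hπt s hs
  have ht0 : (0 : ℝ) < t := by exact_mod_cast ht
  have hs' := mem_typeClass.1 hs
  have hfrac : (1 - η) * qDot (ν 1) < fracState2 s := by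
    rw [fracState2_eq_qDot p hs'.1]; exact hs'.2
  have hf0 : 0 < fracState2 s := hθ1.trans hfrac
  have hv0 : 0 < σ ^ 2 * fracState2 s / t := by positivity
  have hlow := le_measureReal_abs_sub_lt_of_hasLaw (hG.law t ht s hs'.1)
    (Real.toNNReal_pos.2 hv0) ?_ ξ h2.1
  · rw [Real.coe_toNNReal _ hv0.le] at hlow
    refine le_trans ?_ (hlow.trans (measureReal_mono fun ω hω => hball ?_))
    · have h4 : (|ξ| + η) ^ 2 / (2 * (σ ^ 2 * fracState2 s / t)) ≤
          t * (gaussRate σ ν ξ + ε / 2) := by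
        have h5 : (|ξ| + η) ^ 2 / (2 * (σ ^ 2 * fracState2 s / t)) =
            t * ((|ξ| + η) ^ 2 / (2 * σ ^ 2 * fracState2 s)) := by
          field_simp
        rw [h5]
        refine mul_le_mul_of_nonneg_left (le_trans ?_ h1.le) ht0.le
        gcongr
      calc Real.exp (-(t * (gaussRate σ ν ξ + ε)))
          = Real.exp (-(t * (ε / 2))) * Real.exp (-(t * (gaussRate σ ν ξ + ε / 2))) := by
            rw [← Real.exp_add]; congr 1; ring
        _ ≤ η * Real.exp (-((|ξ| + η) ^ 2 / (2 * (σ ^ 2 * fracState2 s / t)))) := by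
            have hη : 0 < η := h2.1
            gcongr
            rw [Real.exp_neg]
            exact inv_le_of_inv_le₀ h2.1 hηt
    · rw [Metric.mem_ball, Real.dist_eq]
      exact lt_trans hω h3.2
  · rw [Real.coe_toNNReal _ hv0.le, ← mul_div_assoc, div_le_one ht0]
    refine le_trans ?_ hπt
    rw [← mul_assoc]
    exact mul_le_of_le_one_right (by positivity) (fracState2_le_one s)

/-- The mean number of hits is at least `exp (t (h - j))`. As `j < h` it grows exponentially, and
the Chebyshev failure probability `4 exp (-t (h - j))` is summable. -/
theorem ae_eventually_le_hitCount (hG : GaussianField p σ P Z) (U : Set (Fin 2 → Fin Δ → ℝ))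
    {W : Set ℝ} (hW : MeasurableSet W) {h j : ℝ} (hhj : j < h)
    (hcard : ∀ᶠ t : ℕ in atTop, Real.exp (t * h) ≤ (typeClass p t U).card)
    (hprob : ∀ᶠ t : ℕ in atTop, ∀ s ∈ typeClass p t U,
      Real.exp (-(t * j)) ≤ P.real {ω | Z t s ω ∈ W}) :
    ∀ᵐ ω ∂P, ∀ᶠ t : ℕ in atTop,
      1 / 2 * Real.exp (t * (h - j)) ≤ hitCount (typeClass p t U) W (fun s => Z t s ω) := by
  have := ae_eventually_notMem_of_exp_bound P (fun t : ℕ => {ω |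
    hitCount (typeClass p t U) W (fun s => Z t s ω) < 1 / 2 * Real.exp (t * (h - j))}) 4
    (sub_pos.2 hhj) ?_
  · filter_upwards [this] with ω hω
    exact hω.mono fun t ht => not_lt.1 ht
  · filter_upwards [hcard, hprob, eventually_ge_atTop 1] with t h1 h2 ht
    have hm : Real.exp (t * (h - j)) ≤ (typeClass p t U).card * Real.exp (-(t * j)) := by
      rw [mul_sub, sub_eq_add_neg, Real.exp_add]
      gcongr
    have hm0 := (Real.exp_pos (t * (h - j))).trans_le hm
    have h3 := measureReal_hitCount_lt_le P (typeClass p t U) (fun s => Z t s)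
      (fun s hs => hG.aemeasurable ht (mem_typeClass.1 hs).1)
      (fun s hs s' hs' hne => (hG.indep t ht).indepFun
        (i := ⟨s, (mem_typeClass.1 hs).1⟩) (j := ⟨s', (mem_typeClass.1 hs').1⟩)
        (fun h => hne (congrArg Subtype.val h))) hW h2 hm0
    refine (measureReal_mono fun ω hω => ?_).trans (h3.trans ?_)
    · simp only [Set.mem_ofPred_eq] at hω ⊢
      linarith
    · rw [Real.exp_neg (t * (h - j)), ← div_eq_mul_inv]
      gcongr

end GaussianField

/-! ### The rate function -/

theorem gaussRate_nonneg {Δ : ℕ} (σ : ℝ) {ν : Fin 2 → Fin Δ → ℝ} (hν : ν ∈ typeSet Δ) (ξ : ℝ) :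
    0 ≤ gaussRate σ ν ξ := by
  have := qDot_pos_of_mem_typeSet hν 1
  unfold gaussRate; positivity

theorem rate_of_mem {Δ : ℕ} {ψ σ : ℝ} {x : (Fin 2 → Fin Δ → ℝ) × ℝ} (h1 : x.1 ∈ typeSet Δ)
    (h2 : gaussRate σ x.1 x.2 ≤ totalEntropy x.1) :
    rate ψ σ x = ((Real.log ψ - totalEntropy x.1 + gaussRate σ x.1 x.2 : ℝ) : EReal) := by
  rw [rate, if_pos ⟨h1, h2⟩, totalEntropy]
  congr 1; ring

theorem mem_of_rate_lt_top {Δ : ℕ} {ψ σ : ℝ} {x : (Fin 2 → Fin Δ → ℝ) × ℝ} (h : rate ψ σ x < ⊤) :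
    x.1 ∈ typeSet Δ ∧ gaussRate σ x.1 x.2 ≤ totalEntropy x.1 := by
  by_contra hno
  rw [totalEntropy] at hno
  rw [rate, if_neg hno] at h
  exact lt_irrefl _ h

theorem rate_nonneg {Δ : ℕ} {ψ : ℝ} (hψ : 0 < ψ)
    (hroot : ψ ^ Δ = ∑ i ∈ Finset.range Δ, ψ ^ i) (σ : ℝ) (x : (Fin 2 → Fin Δ → ℝ) × ℝ) :
    0 ≤ rate ψ σ x := by
  by_cases h : rate ψ σ x < ⊤
  · obtain ⟨h1, h2⟩ := mem_of_rate_lt_top h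
    rw [rate_of_mem h1 h2, EReal.coe_nonneg]
    linarith [totalEntropy_le_log hψ hroot h1, gaussRate_nonneg σ h1 x.2]
  · rw [not_lt_top_iff.1 h]; exact le_top

/-- Entropy and `gaussRate` are continuous on the closed set of types, where the denominator is
positive. So the constraint set is closed and the rate is continuous on it. -/
theorem lowerSemicontinuous_rate {Δ : ℕ} (ψ : ℝ) {σ : ℝ} (hσ : 0 < σ) :
    LowerSemicontinuous (rate ψ σ : (Fin 2 → Fin Δ → ℝ) × ℝ → EReal) := by
  set S : Set ((Fin 2 → Fin Δ → ℝ) × ℝ) := {x | x.1 ∈ typeSet Δ} with hSdef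
  have hS : IsClosed S := (isClosed_typeSet Δ).preimage continuous_fst
  have hH : ContinuousOn (fun x : (Fin 2 → Fin Δ → ℝ) × ℝ => totalEntropy x.1) S :=
    (continuousOn_totalEntropy Δ).comp continuous_fst.continuousOn fun x hx => hx
  have hJ : ContinuousOn (fun x : (Fin 2 → Fin Δ → ℝ) × ℝ => gaussRate σ x.1 x.2) S := by
    unfold gaussRate
    refine ContinuousOn.div (by fun_prop) ?_ fun x hx => ?_
    · exact (continuous_const.mul (continuous_qDot.comp
        ((continuous_apply 1).comp continuous_fst))).continuousOn
    · have := qDot_pos_of_mem_typeSet hx 1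
      positivity
  have hK : IsClosed (S ∩ (fun x => totalEntropy x.1 - gaussRate σ x.1 x.2) ⁻¹' Set.Ici 0) :=
    (hH.sub hJ).preimage_isClosed_of_isClosed hS isClosed_Ici
  rw [lowerSemicontinuous_iff_isClosed_preimage]
  intro y
  induction y with
  | top => simp
  | bot =>
    convert isClosed_empty
    ext x
    simp only [Set.mem_preimage, Set.mem_Iic, le_bot_iff, Set.mem_empty_iff_false, iff_false]
    intro h
    have hlt : rate ψ σ x < ⊤ := by rw [h]; exact bot_lt_top
    obtain ⟨h1, h2⟩ := mem_of_rate_lt_top hlt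
    rw [rate_of_mem h1 h2] at h
    exact EReal.coe_ne_bot _ h
  | coe y =>
    have hg : ContinuousOn (fun x : (Fin 2 → Fin Δ → ℝ) × ℝ =>
        Real.log ψ - totalEntropy x.1 + gaussRate σ x.1 x.2) S :=
      (continuousOn_const.sub hH).add hJ
    convert (hg.mono Set.inter_subset_left).preimage_isClosed_of_isClosed hK
      (isClosed_Iic (a := y)) using 1
    ext x
    simp only [Set.mem_preimage, Set.mem_Iic, Set.mem_inter_iff, Set.mem_Ici, sub_nonneg]
    constructor
    · intro h
      obtain ⟨h1, h2⟩ := mem_of_rate_lt_top (h.trans_lt (EReal.coe_lt_top y))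
      rw [rate_of_mem h1 h2, EReal.coe_le_coe_iff] at h
      exact ⟨⟨h1, h2⟩, h⟩
    · rintro ⟨⟨h1, h2⟩, h⟩
      rw [rate_of_mem h1 h2, EReal.coe_le_coe_iff]
      exact h

/-! ### Almost sure upper and lower bounds -/

namespace GaussianField

variable {Δ : ℕ} {p : Fin 2 → Fin Δ → ℝ} {σ ψ : ℝ} {Ω : Type*} [MeasurableSpace Ω]
  {P : Measure Ω} {Z : (t : ℕ) → (Fin t → Fin 2) → Ω → ℝ}

theorem ae_empMeasure_le (hG : GaussianField p σ P Z) (hψ : 0 < ψ)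
    (hroot : ψ ^ Δ = ∑ i ∈ Finset.range Δ, ψ ^ i) {U : Set (Fin 2 → Fin Δ → ℝ)} {W : Set ℝ} {a : ℝ}
    (h : ∀ᵐ ω ∂P, ∀ᶠ t : ℕ in atTop, hitCount (typeClass p t U) W (fun s => Z t s ω) ≤
      Real.exp (t * (Real.log ψ - a))) :
    ∃ M : ℝ, 0 ≤ M ∧ ∀ᵐ ω ∂P, ∀ᶠ t : ℕ in atTop,
      empMeasure p t (fun s => Z t s ω) (U ×ˢ W) ≤ ENNReal.ofReal (M * Real.exp (-(t * a))) := by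
  obtain ⟨κ, hκ, hcard⟩ := card_feasible_bounds p hG.pos hψ hroot
  refine ⟨κ⁻¹, (inv_pos.2 hκ).le, ?_⟩
  filter_upwards [h] with ω hω
  filter_upwards [hω, eventually_ge_atTop 1] with t ht ht1
  have h1 := (hcard t ht1).1
  have h2 : 0 < κ * Real.exp (t * Real.log ψ) := by positivity
  rw [empMeasure_prod p t _ (h2.trans_le h1)]
  apply ENNReal.ofReal_le_ofReal
  calc _ ≤ Real.exp (t * (Real.log ψ - a)) / (κ * Real.exp (t * Real.log ψ)) := by
        gcongr
    _ = κ⁻¹ * Real.exp (-(t * a)) := by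
        rw [div_eq_iff h2.ne']
        have : κ⁻¹ * Real.exp (-(t * a)) * (κ * Real.exp (t * Real.log ψ)) =
            Real.exp (-(t * a)) * Real.exp (t * Real.log ψ) := by field_simp
        rw [this, ← Real.exp_add]
        congr 1; ring

theorem ae_le_empMeasure (hG : GaussianField p σ P Z) (hψ : 0 < ψ)
    (hroot : ψ ^ Δ = ∑ i ∈ Finset.range Δ, ψ ^ i) {U : Set (Fin 2 → Fin Δ → ℝ)} {W : Set ℝ}
    {M b : ℝ} (h : ∀ᵐ ω ∂P, ∀ᶠ t : ℕ in atTop,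
      M * Real.exp (t * b) ≤ hitCount (typeClass p t U) W (fun s => Z t s ω)) :
    ∀ᵐ ω ∂P, ∀ᶠ t : ℕ in atTop, ENNReal.ofReal (M * Real.exp (-(t * (Real.log ψ - b)))) ≤
      empMeasure p t (fun s => Z t s ω) (U ×ˢ W) := by
  obtain ⟨κ, hκ, hcard⟩ := card_feasible_bounds p hG.pos hψ hroot
  filter_upwards [h] with ω hω
  filter_upwards [hω, eventually_ge_atTop 1] with t ht ht1
  have h1 := (hcard t ht1).1
  have h2 : 0 < κ * Real.exp (t * Real.log ψ) := by positivity
  rw [empMeasure_prod p t _ (h2.trans_le h1)]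
  apply ENNReal.ofReal_le_ofReal
  calc M * Real.exp (-(t * (Real.log ψ - b)))
      = M * Real.exp (t * b) / Real.exp (t * Real.log ψ) := by
        rw [mul_div_assoc, ← Real.exp_sub]
        congr 2; ring
    _ ≤ _ := div_le_div₀ (hitCount_nonneg _ _ _) ht (h2.trans_le h1) (hcard t ht1).2

variable [IsProbabilityMeasure P]

theorem upper_local (hG : GaussianField p σ P Z) (hψ : 0 < ψ)
    (hroot : ψ ^ Δ = ∑ i ∈ Finset.range Δ, ψ ^ i) (x : (Fin 2 → Fin Δ → ℝ) × ℝ) {a : ℝ}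
    (ha : (a : EReal) < rate ψ σ x) :
    ∃ A ∈ 𝓝 x, ∃ M : ℝ, 0 ≤ M ∧ ∀ᵐ ω ∂P, ∀ᶠ t : ℕ in atTop,
      empMeasure p t (fun s => Z t s ω) A ≤ ENNReal.ofReal (M * Real.exp (-(t * a))) := by
  suffices h : ∃ U ∈ 𝓝 x.1, ∃ W ∈ 𝓝 x.2, ∀ᵐ ω ∂P, ∀ᶠ t : ℕ in atTop,
      hitCount (typeClass p t U) W (fun s => Z t s ω) ≤ Real.exp (t * (Real.log ψ - a)) by
    obtain ⟨U, hU, W, hW, h⟩ := h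
    exact ⟨U ×ˢ W, prod_mem_nhds hU hW, hG.ae_empMeasure_le hψ hroot h⟩
  by_cases hν : x.1 ∈ typeSet Δ
  swap
  · obtain ⟨U, hU, hemp⟩ := exists_nhds_typeClass_eq_empty p hν
    refine ⟨U, hU, Set.univ, univ_mem, ae_of_all _ fun ω => ?_⟩
    filter_upwards [hemp] with t ht
    rw [ht, hitCount, Finset.sum_empty]
    exact (Real.exp_pos _).le
  -- One `ε` pays for the count, one for the Gaussian tail, and one is the Borel–Cantelli decay
  -- rate.
  have key : ∀ ε > 0, ∃ U ∈ 𝓝 x.1, ∃ W ∈ 𝓝 x.2, ∀ b,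
      totalEntropy x.1 - gaussRate σ x.1 x.2 + 3 * ε ≤ b → ∀ᵐ ω ∂P, ∀ᶠ t : ℕ in atTop,
        hitCount (typeClass p t U) W (fun s => Z t s ω) < Real.exp (t * b) := by
    intro ε hε
    obtain ⟨U₁, hU₁, hcard⟩ := exists_nhds_card_typeClass_le p hG.pos hν hε
    obtain ⟨U₂, hU₂, W, hW, hWm, hprob⟩ := hG.exists_nhds_tail hν x.2 hε
    refine ⟨U₁ ∩ U₂, inter_mem hU₁ hU₂, W, hW, fun b hb => ?_⟩
    refine hG.ae_eventually_hitCount_lt (U₁ ∩ U₂) hWm hε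
      (h := totalEntropy x.1 + ε) (j := gaussRate σ x.1 x.2 - ε) (by linarith) ?_ ?_
    · filter_upwards [eventually_ge_atTop 1] with t ht
      refine le_trans ?_ (hcard t ht)
      exact_mod_cast Finset.card_le_card (typeClass_mono p t Set.inter_subset_left)
    · filter_upwards [hprob] with t ht s hs
      exact ht s (typeClass_mono p t Set.inter_subset_right hs)
  by_cases hJ : gaussRate σ x.1 x.2 ≤ totalEntropy x.1
  · rw [rate_of_mem hν hJ, EReal.coe_lt_coe_iff] at ha
    set ε := (Real.log ψ - totalEntropy x.1 + gaussRate σ x.1 x.2 - a) / 3 with hε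
    obtain ⟨U, hU, W, hW, h⟩ := key ε (by rw [hε]; linarith)
    refine ⟨U, hU, W, hW, ?_⟩
    filter_upwards [h (Real.log ψ - a) (by rw [hε]; linarith)] with ω hω
    exact hω.mono fun t ht => ht.le
  -- Here `H < J`, so exponent `0`, that is threshold `1`, is allowed in `key`. Fewer than one hit
  -- means none, which beats every finite `a`.
  · set ε := (gaussRate σ x.1 x.2 - totalEntropy x.1) / 3 with hε
    obtain ⟨U, hU, W, hW, h⟩ := key ε (by rw [hε]; linarith)
    refine ⟨U, hU, W, hW, ?_⟩
    filter_upwards [h 0 (by rw [hε]; linarith)] with ω hω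
    filter_upwards [hω] with t ht
    rw [mul_zero, Real.exp_zero] at ht
    rw [hitCount_eq_zero_of_lt_one ht]
    exact (Real.exp_pos _).le

/-- A strong form of exponential tightness: types lie in the unit cube, and beyond `R` the Gaussian
tail beats the number of sequences. -/
theorem exists_compact_ae_empMeasure_compl_eq_zero (hG : GaussianField p σ P Z) (hψ : 0 < ψ)
    (hroot : ψ ^ Δ = ∑ i ∈ Finset.range Δ, ψ ^ i) :
    ∃ K : Set ((Fin 2 → Fin Δ → ℝ) × ℝ), IsCompact K ∧ ∀ᵐ ω ∂P, ∀ᶠ t : ℕ in atTop,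
      empMeasure p t (fun s => Z t s ω) Kᶜ = 0 := by
  obtain ⟨κ, hκ, hcard⟩ := card_feasible_bounds p hG.pos hψ hroot
  have hσ := hG.sigma_pos
  -- Chosen so that the tail exponent `R² / (2σ²)`, valid since `Θ₂ ≤ 1`, exceeds the growth rate
  -- `log ψ` by at least `1`.
  set R := σ * √(2 * (|Real.log ψ| + 1)) with hR
  have hR0 : 0 ≤ R := by positivity
  have hRsq : R ^ 2 / (2 * σ ^ 2 * 1) = |Real.log ψ| + 1 := by
    rw [hR, mul_pow, Real.sq_sqrt (by positivity)]
    field_simp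
  have hhit := hG.ae_eventually_hitCount_lt Set.univ (W := {z | R ≤ |z|})
    (isClosed_le continuous_const continuous_abs).measurableSet (h := Real.log ψ)
    (j := |Real.log ψ| + 1) (a := 0) one_pos (by linarith [le_abs_self (Real.log ψ)]) ?_ ?_
  · refine ⟨Set.Icc 0 1 ×ˢ Set.Icc (-R) R, isCompact_Icc.prod isCompact_Icc, ?_⟩
    filter_upwards [hhit] with ω hω
    filter_upwards [hω, eventually_ge_atTop 1] with t ht ht1
    rw [mul_zero, Real.exp_zero] at ht
    have h1 := (hcard t ht1).1
    have h2 : 0 < κ * Real.exp (t * Real.log ψ) := by positivity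
    have hsub : (Set.Icc (0 : Fin 2 → Fin Δ → ℝ) 1 ×ˢ Set.Icc (-R) R)ᶜ ⊆
        ((Set.Icc 0 1)ᶜ ×ˢ Set.univ) ∪ (Set.univ ×ˢ {z | R ≤ |z|}) := by
      intro x hx
      by_cases hx1 : x.1 ∈ Set.Icc (0 : Fin 2 → Fin Δ → ℝ) 1
      · refine Or.inr ⟨Set.mem_univ _, ?_⟩
        by_contra hlt
        exact hx ⟨hx1, abs_le.1 (le_of_not_ge hlt)⟩
      · exact Or.inl ⟨hx1, Set.mem_univ _⟩
    refine measure_mono_null hsub (measure_union_null ?_ ?_)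
    · rw [empMeasure_prod p t _ (h2.trans_le h1), hitCount, Finset.sum_eq_zero]
      · simp
      · intro s hs
        exact absurd ⟨fun m d => seqType_nonneg s m d, fun m d => seqType_le_one ht1 s m d⟩
          (mem_typeClass.1 hs).2
    · rw [empMeasure_prod p t _ (h2.trans_le h1), hitCount_eq_zero_of_lt_one ht]
      simp
  · filter_upwards [eventually_ge_atTop 1] with t ht
    refine le_trans ?_ (hcard t ht).2
    exact_mod_cast Finset.card_le_card fun s hs => (mem_typeClass.1 hs).1
  · filter_upwards [eventually_ge_atTop 1] with t ht s hs
    rw [← hRsq]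
    exact hG.measureReal_le_abs_le ht (mem_typeClass.1 hs).1 (fracState2_le_one s) hR0

theorem upper_of_lt (hG : GaussianField p σ P Z) (hψ : 0 < ψ)
    (hroot : ψ ^ Δ = ∑ i ∈ Finset.range Δ, ψ ^ i) {F : Set ((Fin 2 → Fin Δ → ℝ) × ℝ)}
    (hF : IsClosed F) {a : ℝ} (ha : (a : EReal) < ⨅ x ∈ F, rate ψ σ x) :
    ∀ᵐ ω ∂P, limsup (fun t : ℕ => ENNReal.log (empMeasure p t (fun s => Z t s ω) F) / (t : EReal))
      atTop ≤ ((-a : ℝ) : EReal) := by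
  obtain ⟨K, hK, hKc⟩ := hG.exists_compact_ae_empMeasure_compl_eq_zero hψ hroot
  have hcov : ∃ M : ℝ, 0 ≤ M ∧ ∀ᵐ ω ∂P, ∀ᶠ t : ℕ in atTop,
      empMeasure p t (fun s => Z t s ω) (K ∩ F) ≤ ENNReal.ofReal (M * Real.exp (-(t * a))) := by
    refine (hK.inter_right hF).induction_on (p := fun A => ∃ M : ℝ, 0 ≤ M ∧ ∀ᵐ ω ∂P,
      ∀ᶠ t : ℕ in atTop, empMeasure p t (fun s => Z t s ω) A ≤
        ENNReal.ofReal (M * Real.exp (-(t * a)))) ?_ ?_ ?_ ?_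
    · exact ⟨0, le_rfl, ae_of_all _ fun ω => Eventually.of_forall fun t => by simp⟩
    · rintro A B hAB ⟨M, hM, h⟩
      exact ⟨M, hM, h.mono fun ω hω => hω.mono fun t ht => (measure_mono hAB).trans ht⟩
    · rintro A B ⟨M, hM, h⟩ ⟨M', hM', h'⟩
      refine ⟨M + M', add_nonneg hM hM', ?_⟩
      filter_upwards [h, h'] with ω hω hω'
      filter_upwards [hω, hω'] with t ht ht'
      rw [add_mul, ENNReal.ofReal_add (by positivity) (by positivity)]
      exact (measure_union_le _ _).trans (add_le_add ht ht')
    · intro x hx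
      obtain ⟨A, hA, h⟩ := hG.upper_local hψ hroot x (ha.trans_le (iInf₂_le x hx.2))
      exact ⟨A, mem_nhdsWithin_of_mem_nhds hA, h⟩
  obtain ⟨M, -, hM⟩ := hcov
  filter_upwards [hM, hKc] with ω h1 h2
  refine limsup_log_div_le (M := M) ?_
  filter_upwards [h1, h2] with t ht1 ht2
  have hsub : F ⊆ (K ∩ F) ∪ Kᶜ := fun x hx => by
    by_cases h : x ∈ K
    · exact Or.inl ⟨h, hx⟩
    · exact Or.inr h
  refine (measure_mono hsub).trans ((measure_union_le _ _).trans ?_)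
  rw [ht2, add_zero]
  exact ht1

theorem lower_of_lt_entropy (hG : GaussianField p σ P Z) (hψ : 0 < ψ)
    (hroot : ψ ^ Δ = ∑ i ∈ Finset.range Δ, ψ ^ i) {E : Set ((Fin 2 → Fin Δ → ℝ) × ℝ)}
    {x : (Fin 2 → Fin Δ → ℝ) × ℝ} (hE : E ∈ 𝓝 x) (hν : x.1 ∈ typeSet Δ)
    (hJ : gaussRate σ x.1 x.2 < totalEntropy x.1) {b : ℝ}
    (hb : Real.log ψ - totalEntropy x.1 + gaussRate σ x.1 x.2 < b) :
    ∃ M > 0, ∀ᵐ ω ∂P, ∀ᶠ t : ℕ in atTop,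
      ENNReal.ofReal (M * Real.exp (-(t * b))) ≤ empMeasure p t (fun s => Z t s ω) E := by
  obtain ⟨U₁, hU₁, W', hW', hsub⟩ := mem_nhds_prod_iff.1 hE
  obtain ⟨W, hWsub, hWo, hxW⟩ := mem_nhds_iff.1 hW'
  -- The count and the Gaussian probability lose `ε` each; `2 * ε` must fit both in the entropy gap
  -- and below `b`.
  obtain ⟨ε, hε, hε1, hε2⟩ : ∃ ε > 0, 2 * ε < totalEntropy x.1 - gaussRate σ x.1 x.2 ∧
      2 * ε < b - (Real.log ψ - totalEntropy x.1 + gaussRate σ x.1 x.2) := by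
    have h1 : 0 < min (totalEntropy x.1 - gaussRate σ x.1 x.2)
      (b - (Real.log ψ - totalEntropy x.1 + gaussRate σ x.1 x.2)) :=
      lt_min (by linarith) (by linarith)
    refine ⟨_, div_pos h1 three_pos, ?_, ?_⟩
    · linarith [min_le_left (totalEntropy x.1 - gaussRate σ x.1 x.2)
        (b - (Real.log ψ - totalEntropy x.1 + gaussRate σ x.1 x.2))]
    · linarith [min_le_right (totalEntropy x.1 - gaussRate σ x.1 x.2)
        (b - (Real.log ψ - totalEntropy x.1 + gaussRate σ x.1 x.2))]
  obtain ⟨U₂, hU₂, hprob⟩ := hG.exists_nhds_lower hν (hWo.mem_nhds hxW) hε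
  have hhit := hG.ae_eventually_le_hitCount (U₁ ∩ U₂) hWo.measurableSet
    (h := totalEntropy x.1 - ε) (j := gaussRate σ x.1 x.2 + ε) (by linarith)
    (eventually_le_card_typeClass p hG.pos hν (inter_mem hU₁ hU₂) hε)
    (hprob.mono fun t ht s hs => ht s (typeClass_mono p t Set.inter_subset_right hs))
  refine ⟨1 / 2, by norm_num, ?_⟩
  filter_upwards [hG.ae_le_empMeasure hψ hroot hhit] with ω hω
  filter_upwards [hω] with t ht
  refine (ENNReal.ofReal_le_ofReal ?_).trans (ht.trans (measure_mono
    ((Set.prod_mono Set.inter_subset_left hWsub).trans hsub)))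
  gcongr
  linarith

/-- Where `H = J = 0` the number of hits need not grow, so Chebyshev gives nothing. Instead one
sequence with type in `U` is taken for each large `t`: its Gaussian is near `0` with probability
exponentially close to one, and a single hit out of at most `ψ ^ t` sequences gives the rate `log
ψ`. -/
theorem lower_of_eq_zero (hG : GaussianField p σ P Z) (hψ : 0 < ψ)
    (hroot : ψ ^ Δ = ∑ i ∈ Finset.range Δ, ψ ^ i) {E : Set ((Fin 2 → Fin Δ → ℝ) × ℝ)}
    {ν : Fin 2 → Fin Δ → ℝ} (hE : E ∈ 𝓝 (ν, (0 : ℝ))) (hν : ν ∈ typeSet Δ) :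
    ∀ᵐ ω ∂P, ∀ᶠ t : ℕ in atTop, ENNReal.ofReal (1 * Real.exp (-(t * Real.log ψ))) ≤
      empMeasure p t (fun s => Z t s ω) E := by
  obtain ⟨U, hU, W, hW, hsub⟩ := mem_nhds_prod_iff.1 hE
  obtain ⟨δ, hδ, hball⟩ := Metric.mem_nhds_iff.1 hW
  have hσ := hG.sigma_pos
  have hhit : ∀ᵐ ω ∂P, ∀ᶠ t : ℕ in atTop,
      1 * Real.exp (t * 0) ≤ hitCount (typeClass p t U) W (fun s => Z t s ω) := by
    have := ae_eventually_notMem_of_exp_bound P (fun t : ℕ => {ω |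
      hitCount (typeClass p t U) W (fun s => Z t s ω) < 1}) 2
      (c := δ ^ 2 / (2 * σ ^ 2 * 1)) (by positivity) ?_
    · filter_upwards [this] with ω hω
      filter_upwards [hω] with t ht
      simpa using ht
    · filter_upwards [eventually_le_card_typeClass p hG.pos hν hU one_pos,
        eventually_ge_atTop 1] with t ht ht1
      obtain ⟨s, hs⟩ : (typeClass p t U).Nonempty := by
        rw [← Finset.card_pos, ← Nat.cast_pos (α := ℝ)]
        exact (Real.exp_pos _).trans_le ht
      refine (measureReal_mono fun ω hω => ?_).trans
        (hG.measureReal_le_abs_le ht1 (mem_typeClass.1 hs).1 (fracState2_le_one s) hδ.le)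
      have h1 := notMem_of_hitCount_lt_one hω s hs
      by_contra hlt
      refine h1 (hball ?_)
      rw [Metric.mem_ball, Real.dist_eq, sub_zero]
      exact lt_of_not_ge hlt
  filter_upwards [hG.ae_le_empMeasure hψ hroot hhit] with ω hω
  filter_upwards [hω] with t ht
  rw [sub_zero] at ht
  exact ht.trans (measure_mono hsub)

theorem lower_of_gt (hG : GaussianField p σ P Z) (hψ : 0 < ψ)
    (hroot : ψ ^ Δ = ∑ i ∈ Finset.range Δ, ψ ^ i) {E : Set ((Fin 2 → Fin Δ → ℝ) × ℝ)}
    (hE : IsOpen E) {b : ℝ} (hb : ⨅ x ∈ E, rate ψ σ x < (b : EReal)) :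
    ∀ᵐ ω ∂P, ((-b : ℝ) : EReal) ≤ liminf (fun t : ℕ =>
      ENNReal.log (empMeasure p t (fun s => Z t s ω) E) / (t : EReal)) atTop := by
  obtain ⟨x, hx⟩ := iInf_lt_iff.1 hb
  obtain ⟨hxE, hx⟩ := iInf_lt_iff.1 hx
  obtain ⟨hν, hJ⟩ := mem_of_rate_lt_top (hx.trans (EReal.coe_lt_top b))
  rw [rate_of_mem hν hJ, EReal.coe_lt_coe_iff] at hx
  suffices h : ∃ M > 0, ∀ᵐ ω ∂P, ∀ᶠ t : ℕ in atTop,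
      ENNReal.ofReal (M * Real.exp (-(t * b))) ≤ empMeasure p t (fun s => Z t s ω) E by
    obtain ⟨M, hM, h⟩ := h
    filter_upwards [h] with ω hω using le_liminf_log_div hM hω
  rcases hJ.lt_or_eq with hlt | heq
  · exact hG.lower_of_lt_entropy hψ hroot (hE.mem_nhds hxE) hν hlt hx
  have hθ := qDot_pos_of_mem_typeSet hν 1
  have hσ := hG.sigma_pos
  by_cases hξ : x.2 = 0
  · have h0 : gaussRate σ x.1 x.2 = 0 := by simp [gaussRate, hξ]
    have hxe : x = (x.1, (0 : ℝ)) := by rw [← hξ]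
    refine ⟨1, one_pos, ?_⟩
    filter_upwards [hG.lower_of_eq_zero hψ hroot (hxe ▸ hE.mem_nhds hxE) hν] with ω hω
    filter_upwards [hω] with t ht
    refine (ENNReal.ofReal_le_ofReal ?_).trans ht
    gcongr
    linarith
  -- On the boundary `J = H` with `ξ ≠ 0`, shrinking `ξ` slightly stays in the open set, makes `J <
  -- H`, and lowers the rate.
  · have hcont : Tendsto (fun η : ℝ => (x.1, (1 - η) * x.2)) (𝓝[>] 0) (𝓝 x) := by
      have h : Continuous fun η : ℝ => (x.1, (1 - η) * x.2) := by fun_prop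
      have h' := h.continuousAt (x := 0)
      rw [ContinuousAt] at h'
      simp only [sub_zero, one_mul, Prod.mk.eta] at h'
      exact h'.mono_left nhdsWithin_le_nhds
    obtain ⟨η, h1, h2⟩ := ((hcont.eventually (hE.mem_nhds hxE)).and
      (Ioo_mem_nhdsGT (zero_lt_one' ℝ))).exists
    have hlt : gaussRate σ x.1 ((1 - η) * x.2) < gaussRate σ x.1 x.2 := by
      unfold gaussRate
      have h3 : 0 < x.2 ^ 2 := by positivity
      have h4 : ((1 - η) * x.2) ^ 2 < x.2 ^ 2 := by
        rw [mul_pow]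
        have : (1 - η) ^ 2 < 1 := by nlinarith [h2.1, h2.2]
        nlinarith
      gcongr
    exact hG.lower_of_lt_entropy hψ hroot (x := (x.1, (1 - η) * x.2)) (hE.mem_nhds h1) hν
      (hlt.trans_le hJ) (by simp only; linarith)

/-- The null set depends on the level compared with the infimum; countably many rational levels
suffice, also when the infimum is infinite. -/
theorem satisfiesLDPAlmostSurely (hG : GaussianField p σ P Z) (hψ : 0 < ψ)
    (hroot : ψ ^ Δ = ∑ i ∈ Finset.range Δ, ψ ^ i) :
    SatisfiesLDPAlmostSurely P (fun t ω => empMeasure p t fun s => Z t s ω) (rate ψ σ) where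
  nonneg := rate_nonneg hψ hroot σ
  lowerSemicontinuous := lowerSemicontinuous_rate ψ hG.sigma_pos
  upper F hF := by
    have h : ∀ᵐ ω ∂P, ∀ a : ℚ, ((a : ℝ) : EReal) < ⨅ x ∈ F, rate ψ σ x →
        limsup (fun t : ℕ => ENNReal.log (empMeasure p t (fun s => Z t s ω) F) / (t : EReal))
          atTop ≤ ((-a : ℝ) : EReal) :=
      ae_all_iff.2 fun a => by
        by_cases ha : ((a : ℝ) : EReal) < ⨅ x ∈ F, rate ψ σ x
        · filter_upwards [hG.upper_of_lt hψ hroot hF ha] with ω hω _ using hω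
        · exact ae_of_all _ fun ω h => absurd h ha
    filter_upwards [h] with ω hω
    rw [EReal.le_neg]
    refine le_of_forall_lt_imp_le_of_dense fun c hc => ?_
    obtain ⟨a, h1, h2⟩ := EReal.lt_iff_exists_rat_btwn.1 hc
    have h3 := hω a h2
    rw [EReal.coe_neg] at h3
    exact h1.le.trans (EReal.le_neg.1 h3)
  lower E hE := by
    have h : ∀ᵐ ω ∂P, ∀ b : ℚ, ⨅ x ∈ E, rate ψ σ x < ((b : ℝ) : EReal) →
        ((-b : ℝ) : EReal) ≤ liminf (fun t : ℕ =>
          ENNReal.log (empMeasure p t (fun s => Z t s ω) E) / (t : EReal)) atTop :=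
      ae_all_iff.2 fun b => by
        by_cases hb : ⨅ x ∈ E, rate ψ σ x < ((b : ℝ) : EReal)
        · filter_upwards [hG.lower_of_gt hψ hroot hE hb] with ω hω _ using hω
        · exact ae_of_all _ fun ω h => absurd h hb
    filter_upwards [h] with ω hω
    refine le_of_forall_lt_imp_le_of_dense fun c hc => ?_
    obtain ⟨b, h1, h2⟩ := EReal.lt_iff_exists_rat_btwn.1 (EReal.lt_neg_comm.1 hc)
    refine le_trans ?_ (hω b h1)
    rw [EReal.coe_neg]
    exact (EReal.lt_neg_comm.1 h2).le

end GaussianField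

end RandomDuration

end

theorem theorem2 {Δ : ℕ} (p : Fin 2 → Fin Δ → ℝ)
    (hp_pos : ∀ m d, 0 < p m d) (hp_sum : ∀ m, ∑ d, p m d = 1)
    (ψ : ℝ) (hψ_pos : 0 < ψ) (hψ_root : ψ ^ Δ = ∑ i ∈ Finset.range Δ, ψ ^ i)
    (σ : ℝ) (hσ : 0 < σ)
    {Ω : Type*} [MeasurableSpace Ω] (P : Measure Ω) [IsProbabilityMeasure P]
    (Z : (t : ℕ) → (Fin t → Fin 2) → Ω → ℝ)
    (hZ_indep : ∀ t, 1 ≤ t →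
      iIndepFun (fun s : {s // s ∈ RandomDuration.feasible p t} => Z t s.1) P)
    (hZ_law : ∀ t, 1 ≤ t → ∀ s ∈ RandomDuration.feasible p t,
      HasLaw (Z t s) (gaussianReal 0 (σ ^ 2 * RandomDuration.fracState2 s / t).toNNReal) P) :
    RandomDuration.SatisfiesLDPAlmostSurely P
      (fun t ω => RandomDuration.empMeasure p t fun s => Z t s ω)
      (RandomDuration.rate ψ σ) :=
  RandomDuration.GaussianField.satisfiesLDPAlmostSurely ⟨hp_pos, hσ, hZ_indep, hZ_law⟩ hψ_pos
    hψ_root
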